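/- **Setting.** Manifolds, maps and tensor fields are smooth; manifolds are Hausdorff, second countable and without boundary; semi-Riemannian metrics have constant index (index $0$: Riemannian, index $1$: Lorentzian). Let $\varepsilon\in\{-1,1\}$. A *Lorentzian almost contact* ($\varepsilon=-1$) or *almost paracontact* ($\varepsilon=1$) manifold $M(\phi,\xi,\eta,g_M)$ is an odd-dimensional Lorentzian manifold $(M,g_M)$ with a $(1,1)$-tensor field $\phi$, a vector field $\xi$ and a $1$-form $\eta$ such that $$\phi^2X=\varepsilon X+\eta(X)\xi,\quad g_M(\phi X,\phi Y)=g_M(X,Y)+\eta(X)\eta(Y),\quad \eta(X)=\varepsilon g_M(X,\xi),\quad \eta(\xi)=-\varepsilon .$$ With $\nabla$ the Levi-Civita connection of $g_M$, it is *Lorentzian Sasakian* ($\varepsilon=-1$) or *Lorentzian para Sasakian* ($\varepsilon=1$) if one of the following holds for all vector fields $X,Y$: $$(\nabla_X\phi)Y=\varepsilon g_M(\phi X,\phi Y)\xi+\eta(Y)\phi^2X,\qquad\text{or}\qquad (\nabla_X\phi)Y=g_M(\phi X,\phi Y)\xi+\varepsilon\,\eta(Y)\phi^2X .$$ (For $\varepsilon=1$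 these are the same equation; for $\varepsilon=-1$ they are the two sign conventions, exchanged by $\phi\mapsto-\phi$.) A *semi-Riemannian submersion* $F:(M,g_M)\to(N,g_N)$ is a surjective submersion whose fibres are semi-Riemannian submanifolds of $M$ and whose differential $F_*$ preserves scalar products of vectors normal to the fibres. It is *anti-invariant* if $\phi(\ker F_*)\subseteq(\ker F_*)^\perp$. Let $\mathcal V,\mathcal H$ be the projections of $TM=\ker F_*\oplus(\ker F_*)^\perp$ onto the two summands, let $$A_XY=\mathcal V\nabla_{\mathcal HX}\mathcal HY+\mathcal H\nabla_{\mathcal HX}\mathcal VY,\qquad (\nabla F_*)(X,Y)=\nabla^F_X(F_*Y)-F_*(\nabla_XY),$$ where $\nabla^F$ is the pullback along $F$ of the Levi-Civita connection of $g_N$, and for $X\in\Gamma((\ker F_*)^\perp)$ let $BX=\mathcal V(\phi X)$ be the vertical part of $\phi X$. **Theorem.** Let $F$ be an anti-invariant semi-Riemannian submersion from a Lorentzian Sasakian or Lorentzian para Sasakian manifold $M(\phi,\xi,\eta,g_M)$ onto a Riemannian manifold $(N,g_N)$, and suppose that $\xi$ is vertical, i.e. $\xi\in\Gamma(\ker F_*)$.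 Then the following assertions are equivalent. (i) $(\ker F_*)^\perp$ is integrable, i.e. $[X,Y]\in\Gamma((\ker F_*)^\perp)$ for all $X,Y\in\Gamma((\ker F_*)^\perp)$. (ii) For all $X,Y\in\Gamma((\ker F_*)^\perp)$ and $V\in\Gamma(\ker F_*)$, $$g_N\big((\nabla F_*)(Y,BX),F_*\phi V\big)=g_N\big((\nabla F_*)(X,BY),F_*\phi V\big)+\varepsilon g_M(A_X\xi,\phi A_YV)-\varepsilon g_M(A_Y\xi,\phi A_XV).$$ (iii) For all $X,Y\in\Gamma((\ker F_*)^\perp)$ and $V\in\Gamma(\ker F_*)$, $$g_M(A_XBY-A_YBX,\phi V)=\varepsilon g_M(A_X\xi,\phi A_YV)-\varepsilon g_M(A_Y\xi,\phi A_XV).$$ -/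

import Mathlib

set_option maxSynthPendingDepth 3
set_option linter.unusedSectionVars false

open Bundle Manifold VectorField
open scoped ContDiff

noncomputable section

namespace LorentzianSubmersion

/-! ### Semi-Riemannian metrics and their Levi-Civita connection -/

section Metric

variable (E : Type*) [NormedAddCommGroup E] [NormedSpace ℝ E] [FiniteDimensional ℝ E]
  (M : Type*) [TopologicalSpace M] [ChartedSpace E M] [IsManifold 𝓘(ℝ, E) ∞ M]

/-- A semi-Riemannian metric on `M`: a smooth symmetric nondegenerate `(0,2)`-tensor field of
constant index. The index is the largest dimension of a subspace of a tangent space on which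
the form is negative definite. -/
structure SemiRiemannianMetric where
  val (p : M) : TangentSpace 𝓘(ℝ, E) p →L[ℝ] TangentSpace 𝓘(ℝ, E) p →L[ℝ] ℝ
  symm (p : M) (v w : TangentSpace 𝓘(ℝ, E) p) : val p v w = val p w v
  nondegenerate (p : M) (v : TangentSpace 𝓘(ℝ, E) p) (hv : ∀ w, val p v w = 0) : v = 0
  contMDiff : ContMDiff 𝓘(ℝ, E) (𝓘(ℝ, E).prod 𝓘(ℝ, E →L[ℝ] E →L[ℝ] ℝ)) ∞
    (fun p ↦ TotalSpace.mk' (E →L[ℝ] E →L[ℝ] ℝ) p (val p))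
  index : ℕ
  isGreatest_index (p : M) : IsGreatest
    {k : ℕ | ∃ W : Submodule ℝ (TangentSpace 𝓘(ℝ, E) p),
      Module.finrank ℝ W = k ∧ ∀ w ∈ W, w ≠ 0 → val p w w < 0} index

variable {E M}

/-- `X` is a smooth vector field on `M`. -/
def IsSmoothField (X : Π p : M, TangentSpace 𝓘(ℝ, E) p) : Prop :=
  ContMDiff 𝓘(ℝ, E) (𝓘(ℝ, E).prod 𝓘(ℝ, E)) ∞ (fun p ↦ (⟨p, X p⟩ : TangentBundle 𝓘(ℝ, E) M))

/-- `X` is a smooth section of the distribution `D`. -/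
def IsSectionOf (D : Π p : M, Submodule ℝ (TangentSpace 𝓘(ℝ, E) p))
    (X : Π p : M, TangentSpace 𝓘(ℝ, E) p) : Prop :=
  IsSmoothField X ∧ ∀ p, X p ∈ D p

/-- A distribution is integrable if its sections are closed under the Lie bracket. -/
def IsIntegrable (D : Π p : M, Submodule ℝ (TangentSpace 𝓘(ℝ, E) p)) : Prop :=
  ∀ X Y : Π p : M, TangentSpace 𝓘(ℝ, E) p, IsSectionOf D X → IsSectionOf D Y →
    ∀ p, mlieBracket 𝓘(ℝ, E) X Y p ∈ D p

namespace SemiRiemannianMetric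

variable (g : SemiRiemannianMetric E M)

/-- A Riemannian metric is one of index `0`. -/
def IsRiemannian : Prop := g.index = 0

/-- A Lorentzian metric is one of index `1`. -/
def IsLorentzian : Prop := g.index = 1

instance (p : M) : FiniteDimensional ℝ (TangentSpace 𝓘(ℝ, E) p) :=
  inferInstanceAs (FiniteDimensional ℝ E)

/-- The metric at `p` as a bilinear form on `T_p M`. -/
def bilin (p : M) : LinearMap.BilinForm ℝ (TangentSpace 𝓘(ℝ, E) p) :=
  LinearMap.mk₂ ℝ (fun v w ↦ g.val p v w) (by simp) (by simp) (by simp) (by simp)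

@[simp] lemma bilin_apply (p : M) (v w : TangentSpace 𝓘(ℝ, E) p) :
    g.bilin p v w = g.val p v w := rfl

lemma bilin_isRefl (p : M) : (g.bilin p).IsRefl := by
  intro v w h
  rw [bilin_apply] at h ⊢
  rw [g.symm, h]

lemma bilin_nondegenerate (p : M) : (g.bilin p).Nondegenerate :=
  ⟨fun v hv ↦ g.nondegenerate p v hv,
    fun v hv ↦ g.nondegenerate p v fun w ↦ (g.symm p v w).trans (hv w)⟩

/-- The matrix `(g_ij)` of the metric in the coordinate frame of the preferred chart at `x`,
as a function of the point `q` (meaningful for `q` in the chart domain). -/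
def coordMetric (x q : M) : E →L[ℝ] E →L[ℝ] ℝ :=
  letI e := (trivializationAt E (TangentSpace 𝓘(ℝ, E)) x).symmL ℝ q
  (ContinuousLinearMap.precomp ℝ e) ∘L (g.val q) ∘L e

lemma coordMetric_apply (x q : M) (u v : E) :
    g.coordMetric x q u v = g.val q ((trivializationAt E (TangentSpace 𝓘(ℝ, E)) x).symmL ℝ q u)
      ((trivializationAt E (TangentSpace 𝓘(ℝ, E)) x).symmL ℝ q v) := rfl

/-- The partial derivatives `∂_u g_vw` at `x` in the preferred chart at `x`. -/
def coordMetricDeriv (x : M) : E →L[ℝ] E →L[ℝ] E →L[ℝ] ℝ :=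
  mvfderiv 𝓘(ℝ, E) (g.coordMetric x) x

/-- The Christoffel symbol of the first kind,
`Γ(u,v;w) = (∂_u g_vw + ∂_v g_uw - ∂_w g_uv) / 2`, at `x` in the preferred chart at `x`. -/
def christoffelFirst (x : M) : E →L[ℝ] E →L[ℝ] E →L[ℝ] ℝ :=
  letI D := g.coordMetricDeriv x
  (1 / 2 : ℝ) • (D + D.flip -
    (ContinuousLinearMap.flipₗᵢ ℝ E E ℝ).toContinuousLinearEquiv.toContinuousLinearMap ∘L D.flip)

lemma christoffelFirst_apply (x : M) (u v w : E) :
    g.christoffelFirst x u v w = 1 / 2 * (g.coordMetricDeriv x u v w +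
      g.coordMetricDeriv x v u w - g.coordMetricDeriv x w u v) := rfl

/-- The inverse of `v ↦ g_x(v, ·)`. -/
def sharp (x : M) : (E →L[ℝ] ℝ) →L[ℝ] E :=
  LinearMap.toContinuousLinearMap
    (((g.bilin x).toDual (g.bilin_nondegenerate x)).symm.toLinearMap ∘ₗ
      ContinuousLinearMap.coeLM ℝ : (E →L[ℝ] ℝ) →ₗ[ℝ] E)

lemma val_sharp (x : M) (l : E →L[ℝ] ℝ) (w : TangentSpace 𝓘(ℝ, E) x) :
    g.val x (g.sharp x l : E) w = l w :=
  LinearMap.BilinForm.apply_toDual_symm_apply (hB := g.bilin_nondegenerate x) _ w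

/-- The Christoffel symbol (of the second kind) `Γ(u,v)`, at `x` in the preferred chart at `x`:
`g(Γ(u,v), w) = Γ(u,v;w)` for all `w`. -/
def christoffel (x : M) : E →L[ℝ] E →L[ℝ] E :=
  (ContinuousLinearMap.compL ℝ E (E →L[ℝ] ℝ) E (g.sharp x)) ∘L g.christoffelFirst x

lemma val_christoffel (x : M) (u v : E) (w : TangentSpace 𝓘(ℝ, E) x) :
    g.val x (g.christoffel x u v : E) w = g.christoffelFirst x u v w :=
  g.val_sharp x _ w

end SemiRiemannianMetric

/-- The components of the vector field `Y` in the coordinate frame of the preferred chart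
at `p`. -/
def coordField (Y : Π p : M, TangentSpace 𝓘(ℝ, E) p) (p q : M) : E :=
  (trivializationAt E (TangentSpace 𝓘(ℝ, E)) p ⟨q, Y q⟩).2

/-- The differential at `p` of the components of `Y` in the coordinate frame of the preferred chart
at `p`. -/
def coordFieldDeriv (Y : Π p : M, TangentSpace 𝓘(ℝ, E) p) (p : M) : E →L[ℝ] E :=
  mvfderiv 𝓘(ℝ, E) (coordField Y p) p

lemma coordFieldDeriv_add {Y Y' : Π p : M, TangentSpace 𝓘(ℝ, E) p} {p : M}
    (hY : MDiffAt (T% Y) p) (hY' : MDiffAt (T% Y') p) :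
    coordFieldDeriv (Y + Y') p = coordFieldDeriv Y p + coordFieldDeriv Y' p := by
  rw [mdifferentiableAt_section] at hY hY'
  have h : coordField (Y + Y') p =ᶠ[nhds p] coordField Y p + coordField Y' p := by
    filter_upwards [(trivializationAt E (TangentSpace 𝓘(ℝ, E)) p).open_baseSet.mem_nhds
      (FiberBundle.mem_baseSet_trivializationAt' p)] with q hq
    exact ((trivializationAt E (TangentSpace 𝓘(ℝ, E)) p).linear ℝ hq).map_add _ _
  have h1 : mvfderiv 𝓘(ℝ, E) (coordField (Y + Y') p) p =
      mvfderiv 𝓘(ℝ, E) (coordField Y p + coordField Y' p) p := by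
    ext v
    exact congrArg (fun L : E →L[ℝ] E ↦ L v) h.mfderiv_eq
  exact h1.trans (mvfderiv_add hY hY')

lemma coordFieldDeriv_smul {Y : Π p : M, TangentSpace 𝓘(ℝ, E) p} {f : M → ℝ} {p : M}
    (hY : MDiffAt (T% Y) p) (hf : MDiffAt f p) :
    coordFieldDeriv (f • Y) p = f p • coordFieldDeriv Y p +
      (show E →L[ℝ] ℝ from mvfderiv 𝓘(ℝ, E) f p).smulRight (coordField Y p p) := by
  rw [mdifferentiableAt_section] at hY
  have h : coordField (f • Y) p =ᶠ[nhds p] f • coordField Y p := by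
    filter_upwards [(trivializationAt E (TangentSpace 𝓘(ℝ, E)) p).open_baseSet.mem_nhds
      (FiberBundle.mem_baseSet_trivializationAt' p)] with q hq
    exact ((trivializationAt E (TangentSpace 𝓘(ℝ, E)) p).linear ℝ hq).map_smul _ _
  have h1 : mvfderiv 𝓘(ℝ, E) (coordField (f • Y) p) p =
      mvfderiv 𝓘(ℝ, E) (f • coordField Y p) p := by
    ext v
    exact congrArg (fun L : E →L[ℝ] E ↦ L v) h.mfderiv_eq
  exact h1.trans (mvfderiv_smul hf hY)

lemma coordField_self (Y : Π p : M, TangentSpace 𝓘(ℝ, E) p) (p : M) :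
    coordField Y p p = Y p :=
  (tangentBundleCore 𝓘(ℝ, E) M).coordChange_self (achart E p) p (mem_chart_source E p) (Y p)

namespace SemiRiemannianMetric

variable (g : SemiRiemannianMetric E M)

/-- The Levi-Civita connection of `g`: `(∇_v Y)(p) = dY(v) + Γ(v, Y p)`, computed in the
coordinate frame of the preferred chart at `p`. -/
def leviCivita : CovariantDerivative 𝓘(ℝ, E) E (TangentSpace 𝓘(ℝ, E) : M → Type _) where
  toFun Y p := coordFieldDeriv Y p + (g.christoffel p).flip (Y p)
  isCovariantDerivativeOnUniv :=
    { add := by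
        intro Y Y' p hY hY' _
        have h : (g.christoffel p).flip (Y p + Y' p : E) = (g.christoffel p).flip (Y p) +
          (g.christoffel p).flip (Y' p) := map_add (g.christoffel p).flip (Y p : E) (Y' p)
        change coordFieldDeriv (Y + Y') p + (g.christoffel p).flip (Y p + Y' p : E) =
          (coordFieldDeriv Y p + (g.christoffel p).flip (Y p)) +
            (coordFieldDeriv Y' p + (g.christoffel p).flip (Y' p))
        rw [h, coordFieldDeriv_add hY hY']
        abel
      leibniz := by
        intro Y f p hY hf _
        have h : (g.christoffel p).flip (f p • Y p : E) = f p • (g.christoffel p).flip (Y p) :=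
          map_smul (g.christoffel p).flip (f p) (Y p : E)
        change coordFieldDeriv (f • Y) p + (g.christoffel p).flip (f p • Y p : E) =
          f p • (coordFieldDeriv Y p + (g.christoffel p).flip (Y p)) +
            ContinuousLinearMap.smulRight (M₂ := E) (show E →L[ℝ] ℝ from mvfderiv 𝓘(ℝ, E) f p) (Y p)
        rw [h, coordFieldDeriv_smul hY hf, coordField_self, smul_add]
        abel }

lemma leviCivita_apply (Y : Π p : M, TangentSpace 𝓘(ℝ, E) p) (p : M)
    (v : TangentSpace 𝓘(ℝ, E) p) :
    g.leviCivita Y p v = (coordFieldDeriv Y p v + g.christoffel p v (Y p) : E) := rfl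

end SemiRiemannianMetric
end Metric

/-! ### Semi-Riemannian submersions and O'Neill's tensor `A` -/

section Submersion

variable {E : Type*} [NormedAddCommGroup E] [NormedSpace ℝ E] [FiniteDimensional ℝ E]
  {M : Type*} [TopologicalSpace M] [ChartedSpace E M] [IsManifold 𝓘(ℝ, E) ∞ M]
  {E' : Type*} [NormedAddCommGroup E'] [NormedSpace ℝ E'] [FiniteDimensional ℝ E']
  {N : Type*} [TopologicalSpace N] [ChartedSpace E' N] [IsManifold 𝓘(ℝ, E') ∞ N]

variable (gM : SemiRiemannianMetric E M) (gN : SemiRiemannianMetric E' N) (F : M → N)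

/-- The vertical distribution `ker F_*`. -/
def vertical (F : M → N) (p : M) : Submodule ℝ (TangentSpace 𝓘(ℝ, E) p) :=
  LinearMap.ker (mfderiv 𝓘(ℝ, E) 𝓘(ℝ, E') F p).toLinearMap

/-- The horizontal distribution `(ker F_*)^⊥`. -/
def horizontal (p : M) : Submodule ℝ (TangentSpace 𝓘(ℝ, E) p) :=
  (gM.bilin p).orthogonal (vertical (E := E) (E' := E') F p)

/-- A semi-Riemannian submersion of `(M, gM)` onto `(N, gN)`: a smooth surjective map with
surjective differentials, whose fibres are semi-Riemannian submanifolds (the metric is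
nondegenerate on the tangent spaces `ker F_*` of the fibres), and whose differential preserves
the scalar products of horizontal vectors. -/
structure IsSemiRiemannianSubmersion : Prop where
  contMDiff : ContMDiff 𝓘(ℝ, E) 𝓘(ℝ, E') ∞ F
  surjective : Function.Surjective F
  surjective_mfderiv (p : M) : Function.Surjective (mfderiv 𝓘(ℝ, E) 𝓘(ℝ, E') F p)
  nondegenerate_fibre (p : M) (v : TangentSpace 𝓘(ℝ, E) p)
    (hv : v ∈ vertical (E := E) (E' := E') F p)
    (h : ∀ w ∈ vertical (E := E) (E' := E') F p, gM.val p v w = 0) : v = 0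
  isometry (p : M) (x y : TangentSpace 𝓘(ℝ, E) p)
    (hx : x ∈ horizontal (E' := E') gM F p) (hy : y ∈ horizontal (E' := E') gM F p) :
    gN.val (F p) (mfderiv 𝓘(ℝ, E) 𝓘(ℝ, E') F p x) (mfderiv 𝓘(ℝ, E) 𝓘(ℝ, E') F p y) =
      gM.val p x y

/-- The pullback `∇^F` along `F` of the Levi-Civita connection of `N`. For a section `σ` of
`F⁻¹TN` one has `∇^F_v σ = dσ(v) + Γ(F_* v, σ)`, computed at `p` in the coordinate frame of the preferred chart
of `N` at `F p`. -/
def pullbackConnection (σ : Π p : M, TangentSpace 𝓘(ℝ, E') (F p)) (p : M)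
    (v : TangentSpace 𝓘(ℝ, E) p) : TangentSpace 𝓘(ℝ, E') (F p) :=
  (mvfderiv 𝓘(ℝ, E) (fun q ↦
      (trivializationAt E' (TangentSpace 𝓘(ℝ, E')) (F p) ⟨F q, σ q⟩).2) p v
    + gN.christoffel (F p) (mfderiv 𝓘(ℝ, E) 𝓘(ℝ, E') F p v) (σ p) : E')

/-- The second fundamental form `(∇F_*)(X, Y) = ∇^F_X (F_* Y) - F_* (∇_X Y)`. -/
def secondFundamentalForm (X Y : Π p : M, TangentSpace 𝓘(ℝ, E) p) (p : M) :
    TangentSpace 𝓘(ℝ, E') (F p) :=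
  pullbackConnection gN F (fun q ↦ mfderiv 𝓘(ℝ, E) 𝓘(ℝ, E') F q (Y q)) p (X p) -
    mfderiv 𝓘(ℝ, E) 𝓘(ℝ, E') F p (gM.leviCivita Y p (X p))

variable {gM gN F}

namespace IsSemiRiemannianSubmersion

lemma isCompl (hF : IsSemiRiemannianSubmersion gM gN F) (p : M) :
    IsCompl (vertical (E := E) (E' := E') F p) (horizontal (E' := E') gM F p) := by
  refine (LinearMap.BilinForm.isCompl_orthogonal_iff_disjoint (gM.bilin_isRefl p)).2 ?_
  rw [Submodule.disjoint_def]
  intro v hv hv'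
  refine hF.nondegenerate_fibre p v hv fun w hw ↦ ?_
  rw [gM.symm]
  exact hv' w hw

variable (hF : IsSemiRiemannianSubmersion gM gN F)

/-- The projection `𝒱` onto `ker F_*` along `(ker F_*)^⊥`. -/
def vertProj (p : M) : TangentSpace 𝓘(ℝ, E) p →ₗ[ℝ] TangentSpace 𝓘(ℝ, E) p :=
  (vertical (E := E) (E' := E') F p).projection (horizontal (E' := E') gM F p) (hF.isCompl p)

/-- The projection `ℋ` onto `(ker F_*)^⊥` along `ker F_*`. -/
def horProj (p : M) : TangentSpace 𝓘(ℝ, E) p →ₗ[ℝ] TangentSpace 𝓘(ℝ, E) p :=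
  (horizontal (E' := E') gM F p).projection (vertical (E := E) (E' := E') F p)
    (hF.isCompl p).symm

/-- O'Neill's tensor `A_X Y = 𝒱 ∇_{ℋX} (ℋY) + ℋ ∇_{ℋX} (𝒱Y)`. -/
def tensorA (X Y : Π p : M, TangentSpace 𝓘(ℝ, E) p) (p : M) : TangentSpace 𝓘(ℝ, E) p :=
  hF.vertProj p (gM.leviCivita (fun q ↦ hF.horProj q (Y q)) p (hF.horProj p (X p))) +
    hF.horProj p (gM.leviCivita (fun q ↦ hF.vertProj q (Y q)) p (hF.horProj p (X p)))

end IsSemiRiemannianSubmersion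
end Submersion

/-! ### Lorentzian almost (para)contact and Lorentzian (para)Sasakian manifolds -/

section Contact

variable {E : Type*} [NormedAddCommGroup E] [NormedSpace ℝ E] [FiniteDimensional ℝ E]
  {M : Type*} [TopologicalSpace M] [ChartedSpace E M] [IsManifold 𝓘(ℝ, E) ∞ M]
  {E' : Type*} [NormedAddCommGroup E'] [NormedSpace ℝ E'] [FiniteDimensional ℝ E']
  {N : Type*} [TopologicalSpace N] [ChartedSpace E' N] [IsManifold 𝓘(ℝ, E') ∞ N]

/-- A Lorentzian almost contact (`ε = -1`) or almost paracontact (`ε = 1`) structure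
`(φ, ξ, η)` on `(M, g)`. -/
structure AlmostContactStructure (g : SemiRiemannianMetric E M) (ε : ℝ) where
  phi (p : M) : TangentSpace 𝓘(ℝ, E) p →L[ℝ] TangentSpace 𝓘(ℝ, E) p
  xi (p : M) : TangentSpace 𝓘(ℝ, E) p
  eta (p : M) : TangentSpace 𝓘(ℝ, E) p →L[ℝ] ℝ
  contMDiff_phi : ContMDiff 𝓘(ℝ, E) (𝓘(ℝ, E).prod 𝓘(ℝ, E →L[ℝ] E)) ∞
    (fun p ↦ TotalSpace.mk' (E →L[ℝ] E)
      (E := fun p : M ↦ TangentSpace 𝓘(ℝ, E) p →L[ℝ] TangentSpace 𝓘(ℝ, E) p) p (phi p))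
  contMDiff_xi : IsSmoothField xi
  contMDiff_eta : ContMDiff 𝓘(ℝ, E) (𝓘(ℝ, E).prod 𝓘(ℝ, E →L[ℝ] ℝ)) ∞
    (fun p ↦ TotalSpace.mk' (E →L[ℝ] ℝ)
      (E := fun p : M ↦ TangentSpace 𝓘(ℝ, E) p →L[ℝ] ℝ) p (eta p))
  sign : ε = -1 ∨ ε = 1
  odd_finrank : Odd (Module.finrank ℝ E)
  isLorentzian : g.IsLorentzian
  phi_phi (p : M) (x : TangentSpace 𝓘(ℝ, E) p) : phi p (phi p x) = ε • x + eta p x • xi p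
  val_phi_phi (p : M) (x y : TangentSpace 𝓘(ℝ, E) p) :
    g.val p (phi p x) (phi p y) = g.val p x y + eta p x * eta p y
  eta_eq (p : M) (x : TangentSpace 𝓘(ℝ, E) p) : eta p x = ε * g.val p x (xi p)
  eta_xi (p : M) : eta p (xi p) = -ε

namespace AlmostContactStructure

variable {g : SemiRiemannianMetric E M} {ε : ℝ} (S : AlmostContactStructure g ε)

/-- The vector field `φ X`. -/
def phiField (X : Π p : M, TangentSpace 𝓘(ℝ, E) p) (p : M) : TangentSpace 𝓘(ℝ, E) p :=
  S.phi p (X p)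

/-- The covariant derivative `(∇_X φ) Y = ∇_X (φ Y) - φ (∇_X Y)`. -/
def covDerivPhi (X Y : Π p : M, TangentSpace 𝓘(ℝ, E) p) (p : M) : TangentSpace 𝓘(ℝ, E) p :=
  g.leviCivita (S.phiField Y) p (X p) - S.phi p (g.leviCivita Y p (X p))

/-- The structure is Lorentzian Sasakian (`ε = -1`) or Lorentzian para Sasakian (`ε = 1`).
For `ε = 1` the two alternatives are the same equation
`(∇_X φ) Y = g(φX, φY) ξ + η(Y) φ² X`. For `ε = -1` they are the two sign conventions for a
Lorentzian Sasakian structure, which are exchanged by `φ ↦ -φ`; they correspond to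
`∇_X ξ = -φ X` and `∇_X ξ = φ X` respectively. -/
def IsSasakian : Prop :=
  (∀ X Y : Π p : M, TangentSpace 𝓘(ℝ, E) p, IsSmoothField X → IsSmoothField Y → ∀ p,
    S.covDerivPhi X Y p = (ε * g.val p (S.phi p (X p)) (S.phi p (Y p))) • S.xi p +
      S.eta p (Y p) • S.phi p (S.phi p (X p))) ∨
  (∀ X Y : Π p : M, TangentSpace 𝓘(ℝ, E) p, IsSmoothField X → IsSmoothField Y → ∀ p,
    S.covDerivPhi X Y p = g.val p (S.phi p (X p)) (S.phi p (Y p)) • S.xi p +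
      (ε * S.eta p (Y p)) • S.phi p (S.phi p (X p)))

/-- `F` is anti-invariant: `φ (ker F_*) ⊆ (ker F_*)^⊥`. -/
def IsAntiInvariant (F : M → N) : Prop :=
  ∀ p, ∀ v ∈ vertical (E := E) (E' := E') F p, S.phi p v ∈ horizontal (E' := E') g F p

/-- The distribution `μ`, the orthogonal complement of `φ (ker F_*)` in `(ker F_*)^⊥`. -/
def mu (F : M → N) (p : M) : Submodule ℝ (TangentSpace 𝓘(ℝ, E) p) :=
  horizontal (E' := E') g F p ⊓
    (g.bilin p).orthogonal ((vertical (E := E) (E' := E') F p).map (S.phi p).toLinearMap)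

variable {gN : SemiRiemannianMetric E' N} {F : M → N}

/-- The component `B X` of `φ X = B X + C X` in `ker F_*`, where `C X` is a section of `μ`. -/
def fieldB (hF : IsSemiRiemannianSubmersion g gN F) (X : Π p : M, TangentSpace 𝓘(ℝ, E) p)
    (p : M) : TangentSpace 𝓘(ℝ, E) p :=
  hF.vertProj p (S.phi p (X p))

lemma fieldB_mem_vertical (hF : IsSemiRiemannianSubmersion g gN F)
    (X : Π p : M, TangentSpace 𝓘(ℝ, E) p) (p : M) :
    S.fieldB hF X p ∈ vertical (E := E) (E' := E') F p :=
  Submodule.projection_apply_mem _ _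

/-- If `F` is anti-invariant and `ξ` is vertical, then `C X = φ X - B X` lies in `μ`. -/
lemma phi_sub_fieldB_mem_mu (hF : IsSemiRiemannianSubmersion g gN F)
    (hanti : S.IsAntiInvariant (E' := E') F)
    (hxi : ∀ p, S.xi p ∈ vertical (E := E) (E' := E') F p)
    (X : Π p : M, TangentSpace 𝓘(ℝ, E) p) (p : M) (hX : X p ∈ horizontal (E' := E') g F p) :
    S.phi p (X p) - S.fieldB hF X p ∈ S.mu (E' := E') F p := by
  refine ⟨?_, ?_⟩
  · have h := Submodule.projection_add_projection_eq_self (hF.isCompl p) (S.phi p (X p))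
    rw [fieldB, IsSemiRiemannianSubmersion.vertProj, sub_eq_of_eq_add' h.symm]
    exact Submodule.projection_apply_mem _ _
  · rintro _ ⟨v, hv, rfl⟩
    have h1 : g.val p v (X p) = 0 := hX v hv
    have h2 : S.eta p (X p) = 0 := by
      rw [S.eta_eq, g.symm, show g.val p (S.xi p) (X p) = 0 from hX _ (hxi p), mul_zero]
    have h3 : g.val p (S.fieldB hF X p) (S.phi p v) = 0 :=
      hanti p v hv _ (S.fieldB_mem_vertical hF X p)
    change g.val p (S.phi p v) (S.phi p (X p) - S.fieldB hF X p) = 0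
    rw [map_sub, S.val_phi_phi, h1, h2, g.symm p _ (S.fieldB hF X p), h3]
    simp

end AlmostContactStructure
end Contact

end LorentzianSubmersion

end

open LorentzianSubmersion

/-! Write `φX = BX + CX` for horizontal `X`, with `CX` the horizontal part. The proof shows that
each of (i) and (iii) forces `C = 0`, and that once `C = 0` the two conditions say the same thing.
Conditions (ii) and (iii) are the same up to sign, because `(∇F_*)(X, W) = -F_*(∇_X W)` for vertical
`W` (`val_secondFundamentalForm`).

The two sign conventions are handled together by a constant `a` with `a² = 1`, and the structure
equation gives `∇_X ξ = a φX` (`leviCivita_xi`). Hence `A_X ξ = a CX` (`tensorA_xi`), so the right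
side of (iii) vanishes when `C = 0`. In that case also `g([X, Y], V) = g(A_X BY - A_Y BX, φV)`
(`val_mlieBracket_of_fieldC_eq_zero`): differentiate `φY = BY` and use that `φ` preserves the metric
up to the `η` terms. So (iii) becomes the vanishing of the vertical part of `[X, Y]`.

Why `C = 0`: the metric is positive definite on horizontal vectors because `N` is Riemannian, and
`φ` is symmetric for `ε = 1` and skew for `ε = -1` (`val_phi_left`). For `ε = 1` no further
assumption is needed. A vertical field preserves the horizontal metric of a submersion
(`val_leviCivita_eq_val_mlieBracket`); applied to `ξ` this gives `g(φX, X) = 0`, and polarization of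
the symmetric form gives `g(φX, Y) = 0` (`val_phi_eq_zero_of_sign_eq_one`). For `ε = -1`,
integrability gives `0 = g([X, Y], ξ) = -2a g(φX, Y)`. Condition (iii) with `V = ξ` and `Y = CX`
gives `g(C²X, C²X) = 0`, hence `C²X = 0`, and skewness then gives `CX = 0`
(`fieldC_eq_zero_of_tensorA`). -/

noncomputable section

namespace LorentzianSubmersion

/-! ### Vector fields and their Lie bracket in the preferred chart -/

section Chart

variable {E : Type*} [NormedAddCommGroup E] [NormedSpace ℝ E] [FiniteDimensional ℝ E]
  {M : Type*} [TopologicalSpace M] [ChartedSpace E M] [IsManifold 𝓘(ℝ, E) ∞ M]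
  {G : Type*} [NormedAddCommGroup G] [NormedSpace ℝ G]

/-- The differential at `p` of a vector-valued function, as a map on the model space. -/
def chartDeriv (f : M → G) (p : M) : E →L[ℝ] G :=
  mvfderiv 𝓘(ℝ, E) f p

/-- The local representative of `f` in the preferred chart at `p` has derivative `df`. -/
lemma hasFDerivAt_comp_extChartAt_symm {f : M → G} {p : M}
    (hf : MDifferentiableAt 𝓘(ℝ, E) 𝓘(ℝ, G) f p) :
    HasFDerivAt (fun y ↦ f ((extChartAt 𝓘(ℝ, E) p).symm y)) (chartDeriv f p)
      (extChartAt 𝓘(ℝ, E) p p) := by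
  have h : HasFDerivWithinAt (fun y ↦ f ((extChartAt 𝓘(ℝ, E) p).symm y)) (chartDeriv f p)
      (Set.range (id : E → E)) (extChartAt 𝓘(ℝ, E) p p) := hf.hasMFDerivAt.2
  rwa [Set.range_id, hasFDerivWithinAt_univ] at h

lemma coordField_eq_mfderiv (Y : Π p : M, TangentSpace 𝓘(ℝ, E) p) {p q : M}
    (hq : q ∈ (chartAt E p).source) :
    coordField Y p q = mfderiv 𝓘(ℝ, E) 𝓘(ℝ, E) (extChartAt 𝓘(ℝ, E) p) q (Y q) := by
  have h : (trivializationAt E (TangentSpace 𝓘(ℝ, E)) p).continuousLinearMapAt ℝ q (Y q) =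
      coordField Y p q := by
    rw [Trivialization.continuousLinearMapAt_apply, Trivialization.coe_linearMapAt_of_mem]
    · rfl
    · exact hq
  exact h.symm.trans
    (DFunLike.congr_fun (TangentBundle.continuousLinearMapAt_trivializationAt hq) (Y q))

/-- The manifold bracket is defined by pulling fields back along the inverse chart. The
differentials of the chart and of its inverse are mutually inverse, so this pullback is the
component function that enters the connection. -/
lemma mpullbackWithin_extChartAt_symm (Y : Π p : M, TangentSpace 𝓘(ℝ, E) p) (p : M) {y : E}
    (hy : y ∈ (extChartAt 𝓘(ℝ, E) p).target) :
    mpullbackWithin 𝓘(ℝ, E) 𝓘(ℝ, E) (extChartAt 𝓘(ℝ, E) p).symm Y (Set.range 𝓘(ℝ, E)) y =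
      coordField Y p ((extChartAt 𝓘(ℝ, E) p).symm y) := by
  have hq := (extChartAt 𝓘(ℝ, E) p).map_target hy
  rw [extChartAt_source] at hq
  rw [coordField_eq_mfderiv Y hq, mpullbackWithin_apply]
  congr 1
  exact ContinuousLinearMap.inverse_eq
    (mfderivWithin_extChartAt_symm_comp_mfderiv_extChartAt hy)
    (mfderiv_extChartAt_comp_mfderivWithin_extChartAt_symm hy)

lemma eventually_mpullbackWithin_extChartAt_symm (Y : Π p : M, TangentSpace 𝓘(ℝ, E) p) (p : M) :
    mpullbackWithin 𝓘(ℝ, E) 𝓘(ℝ, E) (extChartAt 𝓘(ℝ, E) p).symm Y (Set.range 𝓘(ℝ, E))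
      =ᶠ[nhds (extChartAt 𝓘(ℝ, E) p p)]
        fun y ↦ coordField Y p ((extChartAt 𝓘(ℝ, E) p).symm y) := by
  filter_upwards [extChartAt_target_mem_nhds (I := 𝓘(ℝ, E)) p] with y hy
  exact mpullbackWithin_extChartAt_symm Y p hy

lemma mdifferentiableAt_coordField {Y : Π p : M, TangentSpace 𝓘(ℝ, E) p} {p : M}
    (hY : MDiffAt (T% Y) p) : MDifferentiableAt 𝓘(ℝ, E) 𝓘(ℝ, E) (coordField Y p) p := by
  rw [mdifferentiableAt_section] at hY
  exact hY

lemma lieBracketWithin_eq_of_hasFDerivAt {V W V' W' : E → E} {s : Set E} {x : E}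
    {L L' : E →L[ℝ] E} (hs : s = Set.univ) (hV : V =ᶠ[nhds x] V') (hW : W =ᶠ[nhds x] W')
    (hL : HasFDerivAt V' L x) (hL' : HasFDerivAt W' L' x) :
    lieBracketWithin ℝ V W s x = L' (V' x) - L (W' x) := by
  rw [hs, lieBracketWithin_univ, hV.lieBracket_vectorField_eq hW, lieBracket, hL.fderiv,
    hL'.fderiv]

/-- The Lie bracket in the coordinate frame of the preferred chart. -/
lemma mlieBracket_eq_coordFieldDeriv {X Y : Π p : M, TangentSpace 𝓘(ℝ, E) p} {p : M}
    (hX : MDiffAt (T% X) p) (hY : MDiffAt (T% Y) p) :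
    mlieBracket 𝓘(ℝ, E) X Y p = coordFieldDeriv Y p (X p) - coordFieldDeriv X p (Y p) := by
  have hX' := hasFDerivAt_comp_extChartAt_symm (mdifferentiableAt_coordField hX)
  have hY' := hasFDerivAt_comp_extChartAt_symm (mdifferentiableAt_coordField hY)
  have eX := eventually_mpullbackWithin_extChartAt_symm X p
  have eY := eventually_mpullbackWithin_extChartAt_symm Y p
  have h : lieBracketWithin ℝ
      (mpullbackWithin 𝓘(ℝ, E) 𝓘(ℝ, E) (extChartAt 𝓘(ℝ, E) p).symm X (Set.range 𝓘(ℝ, E)))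
      (mpullbackWithin 𝓘(ℝ, E) 𝓘(ℝ, E) (extChartAt 𝓘(ℝ, E) p).symm Y (Set.range 𝓘(ℝ, E)))
      ((extChartAt 𝓘(ℝ, E) p).symm ⁻¹' Set.univ ∩ Set.range 𝓘(ℝ, E)) (extChartAt 𝓘(ℝ, E) p p) =
      coordFieldDeriv Y p (X p) - coordFieldDeriv X p (Y p) := by
    have h := lieBracketWithin_eq_of_hasFDerivAt
      (s := (extChartAt 𝓘(ℝ, E) p).symm ⁻¹' Set.univ ∩ Set.range 𝓘(ℝ, E)) (by simp) eX eY hX' hY'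
    rw [extChartAt_to_inv, coordField_self, coordField_self] at h
    exact h
  -- At the centre of its own chart the tangent space is identified with `E` by the differential of
  -- that chart, so transporting the bracket back changes nothing.
  have h2 : (mfderiv 𝓘(ℝ, E) 𝓘(ℝ, E) (extChartAt 𝓘(ℝ, E) p) p).inverse =
      ContinuousLinearMap.id ℝ E := by
    have h3 : mfderiv 𝓘(ℝ, E) 𝓘(ℝ, E) (extChartAt 𝓘(ℝ, E) p) p = ContinuousLinearMap.id ℝ E :=
      mfderiv_extChartAt_self
    exact (congrArg ContinuousLinearMap.inverse h3).trans ContinuousLinearMap.inverse_id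
  rw [← mlieBracketWithin_univ, mlieBracketWithin_apply]
  exact (DFunLike.congr_fun h2 _).trans h

end Chart

/-! ### The connection is torsion-free and metric -/

section LeviCivita

variable {E : Type*} [NormedAddCommGroup E] [NormedSpace ℝ E] [FiniteDimensional ℝ E]
  {M : Type*} [TopologicalSpace M] [ChartedSpace E M] [IsManifold 𝓘(ℝ, E) ∞ M]

lemma symmL_coordField (Y : Π p : M, TangentSpace 𝓘(ℝ, E) p) {p q : M}
    (hq : q ∈ (trivializationAt E (TangentSpace 𝓘(ℝ, E)) p).baseSet) :
    (trivializationAt E (TangentSpace 𝓘(ℝ, E)) p).symmL ℝ q (coordField Y p q) = Y q :=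
  ((trivializationAt E (TangentSpace 𝓘(ℝ, E)) p).symmL_apply hq _).trans
    ((trivializationAt E (TangentSpace 𝓘(ℝ, E)) p).symm_apply_apply_mk hq (Y q))

lemma baseSet_mem_nhds (p : M) :
    (trivializationAt E (TangentSpace 𝓘(ℝ, E)) p).baseSet ∈ nhds p :=
  (trivializationAt E (TangentSpace 𝓘(ℝ, E)) p).open_baseSet.mem_nhds
    (FiberBundle.mem_baseSet_trivializationAt' p)

lemma tendsto_extChartAt_symm (p : M) :
    Filter.Tendsto (extChartAt 𝓘(ℝ, E) p).symm (nhds (extChartAt 𝓘(ℝ, E) p p)) (nhds p) := by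
  have h := continuousAt_extChartAt_symm (I := 𝓘(ℝ, E)) p
  rwa [ContinuousAt, extChartAt_to_inv] at h

lemma IsSmoothField.mdifferentiableAt {Y : Π p : M, TangentSpace 𝓘(ℝ, E) p}
    (hY : IsSmoothField Y) (p : M) : MDiffAt (T% Y) p :=
  (hY p).mdifferentiableAt (by simp)

namespace SemiRiemannianMetric

variable (g : SemiRiemannianMetric E M)

lemma contMDiffAt_coordMetric (x : M) :
    ContMDiffAt 𝓘(ℝ, E) 𝓘(ℝ, E →L[ℝ] E →L[ℝ] ℝ) ∞ (g.coordMetric x) x := by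
  have h := ((contMDiffAt_hom_bundle (IB := 𝓘(ℝ, E)) _).1 (g.contMDiff x)).2
  refine h.congr_of_eventuallyEq ?_
  filter_upwards [baseSet_mem_nhds (E := E) x] with q hq
  ext u v
  rw [coordMetric_apply, Trivialization.symmL_apply _ hq, Trivialization.symmL_apply _ hq]
  refine ((inCoordinates_apply_eq₂ (F₃ := ℝ) (E₃ := fun _ : M ↦ ℝ) hq hq
    (Set.mem_univ _)).trans ?_).symm
  simp

lemma val_eq_coordMetric (Y Z : Π p : M, TangentSpace 𝓘(ℝ, E) p) {p q : M}
    (hq : q ∈ (trivializationAt E (TangentSpace 𝓘(ℝ, E)) p).baseSet) :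
    g.val q (Y q) (Z q) = g.coordMetric p q (coordField Y p q) (coordField Z p q) := by
  rw [coordMetric_apply, symmL_coordField Y hq, symmL_coordField Z hq]

/-- The metric at `p` as a bilinear form on the model space. -/
def modelVal (p : M) : E →L[ℝ] E →L[ℝ] ℝ :=
  g.val p

lemma coordMetric_self (p : M) : g.coordMetric p p = g.modelVal p := by
  have hs : ∀ w : TangentSpace 𝓘(ℝ, E) p,
      (trivializationAt E (TangentSpace 𝓘(ℝ, E)) p).symmL ℝ p w = w := fun w ↦ by
    have h := symmL_coordField (M := M) (fun q ↦ (w : E)) (FiberBundle.mem_baseSet_trivializationAt' p)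
    exact (congrArg _ (coordField_self (M := M) (fun _ ↦ (w : E)) p)).symm.trans h
  ext u v
  exact congrArg₂ (fun a b ↦ g.val p a b) (hs u) (hs v)

lemma modelVal_symm (p : M) (u v : E) : g.modelVal p u v = g.modelVal p v u :=
  g.symm p u v

lemma modelVal_christoffel (p : M) (u v w : E) :
    g.modelVal p (g.christoffel p u v) w = g.christoffelFirst p u v w :=
  g.val_christoffel p u v w

lemma hasFDerivAt_coordMetric (p : M) :
    HasFDerivAt (fun y ↦ g.coordMetric p ((extChartAt 𝓘(ℝ, E) p).symm y)) (g.coordMetricDeriv p)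
      (extChartAt 𝓘(ℝ, E) p p) :=
  hasFDerivAt_comp_extChartAt_symm ((g.contMDiffAt_coordMetric p).mdifferentiableAt (by simp))

lemma coordMetricDeriv_symm (p : M) (u v w : E) :
    g.coordMetricDeriv p u v w = g.coordMetricDeriv p u w v := by
  have h := (g.hasFDerivAt_coordMetric p)
  have h1 := (h.clm_apply (hasFDerivAt_const v _)).clm_apply (hasFDerivAt_const w _)
  have h2 := (h.clm_apply (hasFDerivAt_const w _)).clm_apply (hasFDerivAt_const v _)
  have h3 : (fun y ↦ g.coordMetric p ((extChartAt 𝓘(ℝ, E) p).symm y) v w) =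
      fun y ↦ g.coordMetric p ((extChartAt 𝓘(ℝ, E) p).symm y) w v := by
    funext y
    rw [coordMetric_apply, g.symm, coordMetric_apply]
  rw [h3] at h1
  simpa using DFunLike.congr_fun (h1.unique h2) u

/-- By nondegeneracy it suffices to compare symbols of the first kind, whose symmetry reduces to
that of `∂_w g_uv` in `u` and `v`. This is what makes the connection torsion-free. -/
lemma christoffel_symm (p : M) (u v : E) : g.christoffel p u v = g.christoffel p v u := by
  have h : ∀ w, g.modelVal p (g.christoffel p u v - g.christoffel p v u) w = 0 := fun w ↦ by
    rw [map_sub, sub_apply, modelVal_christoffel, modelVal_christoffel,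
      christoffelFirst_apply, christoffelFirst_apply, g.coordMetricDeriv_symm p w u v]
    ring
  exact sub_eq_zero.1 (g.nondegenerate p _ h)

/-- The identity `Γ(v,y;z) + Γ(v,z;y) = ∂_v g_yz`, with the derivatives of the components added on.
The right side is arranged as the product rule for `g(Y, Z)` produces it. -/
lemma modelVal_add_christoffel (p : M) (v y z y' z' : E) :
    g.modelVal p (y' + g.christoffel p v y) z + g.modelVal p y (z' + g.christoffel p v z) =
      g.modelVal p y z' + (g.modelVal p y' z + g.coordMetricDeriv p v y z) := by
  rw [map_add, add_apply, map_add, modelVal_christoffel,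
    g.modelVal_symm p y (g.christoffel p v z), modelVal_christoffel, christoffelFirst_apply,
    christoffelFirst_apply, g.coordMetricDeriv_symm p v z y]
  ring

/-- The Levi-Civita connection is torsion-free. -/
lemma leviCivita_sub_leviCivita {X Y : Π p : M, TangentSpace 𝓘(ℝ, E) p} {p : M}
    (hX : MDiffAt (T% X) p) (hY : MDiffAt (T% Y) p) :
    g.leviCivita Y p (X p) - g.leviCivita X p (Y p) = mlieBracket 𝓘(ℝ, E) X Y p := by
  rw [mlieBracket_eq_coordFieldDeriv hX hY]
  have h := add_sub_add_right_eq_sub (coordFieldDeriv Y p (X p)) (coordFieldDeriv X p (Y p))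
    (g.christoffel p (X p) (Y p))
  refine Eq.trans ?_ h
  exact congrArg (fun w : E ↦ coordFieldDeriv Y p (X p) + g.christoffel p (X p) (Y p) -
    (coordFieldDeriv X p (Y p) + w)) (g.christoffel_symm p (Y p) (X p))

/-- The Levi-Civita connection is metric. -/
lemma exists_hasFDerivAt_val {Y Z : Π p : M, TangentSpace 𝓘(ℝ, E) p} {p : M}
    (hY : MDiffAt (T% Y) p) (hZ : MDiffAt (T% Z) p) :
    ∃ L : E →L[ℝ] ℝ, HasFDerivAt (fun y ↦ g.val ((extChartAt 𝓘(ℝ, E) p).symm y)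
        (Y ((extChartAt 𝓘(ℝ, E) p).symm y)) (Z ((extChartAt 𝓘(ℝ, E) p).symm y))) L
        (extChartAt 𝓘(ℝ, E) p p) ∧
      ∀ v : TangentSpace 𝓘(ℝ, E) p, L v =
        g.val p (g.leviCivita Y p v) (Z p) + g.val p (Y p) (g.leviCivita Z p v) := by
  have hG := g.hasFDerivAt_coordMetric p
  have hY' := hasFDerivAt_comp_extChartAt_symm (mdifferentiableAt_coordField hY)
  have hZ' := hasFDerivAt_comp_extChartAt_symm (mdifferentiableAt_coordField hZ)
  refine ⟨_, ((hG.clm_apply hY').clm_apply hZ').congr_of_eventuallyEq ?_, fun v ↦ ?_⟩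
  · filter_upwards [tendsto_extChartAt_symm p (baseSet_mem_nhds (E := E) p)] with y hy
    exact g.val_eq_coordMetric Y Z hy
  · rw [extChartAt_to_inv, coordField_self, coordField_self, coordMetric_self]
    exact (g.modelVal_add_christoffel p v (Y p) (Z p) (coordFieldDeriv Y p v)
      (coordFieldDeriv Z p v)).symm

lemma val_leviCivita_add_of_const {Y Z : Π p : M, TangentSpace 𝓘(ℝ, E) p} {p : M} {c : ℝ}
    (hY : MDiffAt (T% Y) p) (hZ : MDiffAt (T% Z) p) (h : ∀ q, g.val q (Y q) (Z q) = c)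
    (v : TangentSpace 𝓘(ℝ, E) p) :
    g.val p (g.leviCivita Y p v) (Z p) + g.val p (Y p) (g.leviCivita Z p v) = 0 := by
  obtain ⟨L, hL, hv⟩ := g.exists_hasFDerivAt_val hY hZ
  simp only [h] at hL
  rw [← hv, hL.unique (hasFDerivAt_const c _)]
  rfl

end SemiRiemannianMetric

end LeviCivita

/-! ### The differential in coordinates and smoothness of the projections -/

section Submersion

variable {E : Type*} [NormedAddCommGroup E] [NormedSpace ℝ E] [FiniteDimensional ℝ E]
  {M : Type*} [TopologicalSpace M] [ChartedSpace E M] [IsManifold 𝓘(ℝ, E) ∞ M]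
  {E' : Type*} [NormedAddCommGroup E'] [NormedSpace ℝ E'] [FiniteDimensional ℝ E']
  {N : Type*} [TopologicalSpace N] [ChartedSpace E' N] [IsManifold 𝓘(ℝ, E') ∞ N]

/-- The differential of `F` at `q` in the coordinate frames of the preferred charts at `p`
and `F p`. -/
def coordDifferential (F : M → N) (p q : M) : E →L[ℝ] E' :=
  inTangentCoordinates 𝓘(ℝ, E) 𝓘(ℝ, E') id F (mfderiv 𝓘(ℝ, E) 𝓘(ℝ, E') F) p q

lemma contMDiffAt_coordDifferential {F : M → N} (hF : ContMDiff 𝓘(ℝ, E) 𝓘(ℝ, E') ∞ F) (p : M) :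
    ContMDiffAt 𝓘(ℝ, E) 𝓘(ℝ, E →L[ℝ] E') ∞
      (coordDifferential (E := E) (E' := E') F p) p :=
  (hF p).mfderiv_const (by simp)

lemma coordDifferential_apply (F : M → N) {p q : M} (u : E)
    (hq' : F q ∈ (trivializationAt E' (TangentSpace 𝓘(ℝ, E')) (F p)).baseSet) :
    coordDifferential (E := E) F p q u =
      (trivializationAt E' (TangentSpace 𝓘(ℝ, E')) (F p) ⟨F q, mfderiv 𝓘(ℝ, E) 𝓘(ℝ, E') F q
        ((trivializationAt E (TangentSpace 𝓘(ℝ, E)) p).symmL ℝ q u)⟩).2 := by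
  have h := (trivializationAt E' (TangentSpace 𝓘(ℝ, E')) (F p)).coe_linearMapAt_of_mem
    (R := ℝ) hq'
  exact congrFun h (mfderiv 𝓘(ℝ, E) 𝓘(ℝ, E') F q
        ((trivializationAt E (TangentSpace 𝓘(ℝ, E)) p).symmL ℝ q u))

lemma coordDifferential_coordField (F : M → N) (X : Π p : M, TangentSpace 𝓘(ℝ, E) p) {p q : M}
    (hq : q ∈ (trivializationAt E (TangentSpace 𝓘(ℝ, E)) p).baseSet)
    (hq' : F q ∈ (trivializationAt E' (TangentSpace 𝓘(ℝ, E')) (F p)).baseSet) :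
    coordDifferential F p q (coordField X p q) =
      (trivializationAt E' (TangentSpace 𝓘(ℝ, E')) (F p)
        ⟨F q, mfderiv 𝓘(ℝ, E) 𝓘(ℝ, E') F q (X q)⟩).2 := by
  rw [coordDifferential_apply F _ hq', symmL_coordField X hq]

lemma coordDifferential_self (F : M → N) (p : M) (v : E) :
    coordDifferential (E := E) (E' := E') F p p v = mfderiv 𝓘(ℝ, E) 𝓘(ℝ, E') F p v := by
  have h := coordDifferential_coordField (E := E) (E' := E') F (fun _ ↦ (v : E))
    (FiberBundle.mem_baseSet_trivializationAt' p) (FiberBundle.mem_baseSet_trivializationAt' (F p))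
  have h1 : coordField (M := M) (fun _ ↦ (v : E)) p p = v := coordField_self _ _
  rw [h1] at h
  exact h.trans ((tangentBundleCore 𝓘(ℝ, E') N).coordChange_self (achart E' (F p)) (F p)
    (mem_chart_source E' (F p)) _)

/-- The metric of `N` on differentials of `F`, in coordinates. -/
lemma val_mfderiv_eq_coordMetric (gN : SemiRiemannianMetric E' N) (F : M → N) {p q : M} (u w : E)
    (hq' : F q ∈ (trivializationAt E' (TangentSpace 𝓘(ℝ, E')) (F p)).baseSet) :
    gN.coordMetric (F p) (F q) (coordDifferential F p q u) (coordDifferential F p q w) =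
      gN.val (F q)
        (mfderiv 𝓘(ℝ, E) 𝓘(ℝ, E') F q
          ((trivializationAt E (TangentSpace 𝓘(ℝ, E)) p).symmL ℝ q u))
        (mfderiv 𝓘(ℝ, E) 𝓘(ℝ, E') F q
          ((trivializationAt E (TangentSpace 𝓘(ℝ, E)) p).symmL ℝ q w)) := by
  have h : ∀ u : E, (trivializationAt E' (TangentSpace 𝓘(ℝ, E')) (F p)).symmL ℝ (F q)
      (coordDifferential F p q u) = mfderiv 𝓘(ℝ, E) 𝓘(ℝ, E') F q
        ((trivializationAt E (TangentSpace 𝓘(ℝ, E)) p).symmL ℝ q u) := fun u ↦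
    (trivializationAt E' (TangentSpace 𝓘(ℝ, E')) (F p)).symmL_continuousLinearMapAt hq' _
  rw [SemiRiemannianMetric.coordMetric_apply, h, h]

lemma SemiRiemannianMetric.isInvertible_modelVal (g : SemiRiemannianMetric E M) (p : M) :
    (g.modelVal p).IsInvertible := by
  have hinj : Function.Injective ((g.modelVal p).toLinearMap) := by
    rw [← LinearMap.ker_eq_bot, LinearMap.ker_eq_bot']
    intro v hv
    exact g.nondegenerate p v fun w ↦ DFunLike.congr_fun hv w
  have hd : Module.finrank ℝ E = Module.finrank ℝ (E →L[ℝ] ℝ) := by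
    rw [← (LinearMap.toContinuousLinearMap (𝕜 := ℝ) (E := E) (F' := ℝ)).finrank_eq]
    exact (Subspace.dual_finrank_eq).symm
  refine ⟨((LinearEquiv.ofInjectiveOfFinrankEq _ hinj hd).toContinuousLinearEquiv), ?_⟩
  ext v w
  rfl

lemma SemiRiemannianMetric.eventually_isInvertible_coordMetric (g : SemiRiemannianMetric E M)
    (p : M) : ∀ᶠ q in nhds p, (g.coordMetric p q).IsInvertible := by
  obtain ⟨e, he⟩ := g.isInvertible_modelVal p
  refine (g.contMDiffAt_coordMetric p).continuousAt.eventually (p := fun L ↦ L.IsInvertible) ?_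
  rw [g.coordMetric_self, ← he]
  exact ContinuousLinearEquiv.nhds e

namespace IsSemiRiemannianSubmersion

variable {gM : SemiRiemannianMetric E M} {gN : SemiRiemannianMetric E' N} {F : M → N}
  (hF : IsSemiRiemannianSubmersion gM gN F)

include hF

lemma vertProj_add_horProj (p : M) (x : TangentSpace 𝓘(ℝ, E) p) :
    hF.vertProj p x + hF.horProj p x = x :=
  Submodule.projection_add_projection_eq_self (hF.isCompl p) x

lemma vertProj_mem (p : M) (x : TangentSpace 𝓘(ℝ, E) p) :
    hF.vertProj p x ∈ vertical (E := E) (E' := E') F p :=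
  Submodule.projection_apply_mem _ _

lemma horProj_mem (p : M) (x : TangentSpace 𝓘(ℝ, E) p) :
    hF.horProj p x ∈ horizontal (E' := E') gM F p :=
  Submodule.projection_apply_mem _ _

lemma horProj_of_mem {p : M} {x : TangentSpace 𝓘(ℝ, E) p}
    (hx : x ∈ horizontal (E' := E') gM F p) : hF.horProj p x = x :=
  Submodule.projection_apply_of_mem_left _ hx

lemma horProj_of_mem_vertical {p : M} {x : TangentSpace 𝓘(ℝ, E) p}
    (hx : x ∈ vertical (E := E) (E' := E') F p) : hF.horProj p x = 0 :=
  Submodule.projection_apply_of_mem_right _ hx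

lemma vertProj_of_mem {p : M} {x : TangentSpace 𝓘(ℝ, E) p}
    (hx : x ∈ vertical (E := E) (E' := E') F p) : hF.vertProj p x = x :=
  Submodule.projection_apply_of_mem_left _ hx

lemma mfderiv_horProj (p : M) (x : TangentSpace 𝓘(ℝ, E) p) :
    mfderiv 𝓘(ℝ, E) 𝓘(ℝ, E') F p (hF.horProj p x) = mfderiv 𝓘(ℝ, E) 𝓘(ℝ, E') F p x := by
  have h : mfderiv 𝓘(ℝ, E) 𝓘(ℝ, E') F p (hF.vertProj p x) = 0 := hF.vertProj_mem p x
  conv_rhs => rw [← hF.vertProj_add_horProj p x, map_add, h, zero_add]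

lemma val_eq_zero (p : M) {v x : TangentSpace 𝓘(ℝ, E) p}
    (hv : v ∈ vertical (E := E) (E' := E') F p) (hx : x ∈ horizontal (E' := E') gM F p) :
    gM.val p v x = 0 :=
  hx v hv

/-- Both sides see only the horizontal parts of `x` and `w`, on which `F_*` is isometric. The
identity determines `ℋx` by nondegeneracy without a choice of frame, and smoothness of `ℋ` is
deduced from it. -/
lemma val_horProj (p : M) (x w : TangentSpace 𝓘(ℝ, E) p) :
    gM.val p (hF.horProj p x) w = gN.val (F p) (mfderiv 𝓘(ℝ, E) 𝓘(ℝ, E') F p x)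
      (mfderiv 𝓘(ℝ, E) 𝓘(ℝ, E') F p w) := by
  rw [← hF.mfderiv_horProj p x, ← hF.mfderiv_horProj p w,
    hF.isometry p _ _ (hF.horProj_mem p x) (hF.horProj_mem p w)]
  conv_lhs => rw [← hF.vertProj_add_horProj p w, map_add, gM.symm p _ (hF.vertProj p w),
    hF.val_eq_zero p (hF.vertProj_mem p w) (hF.horProj_mem p x), zero_add]

/-- The horizontal projection of a smooth vector field is smooth. -/
lemma isSmoothField_horProj {X : Π p : M, TangentSpace 𝓘(ℝ, E) p} (hX : IsSmoothField X) :
    IsSmoothField (fun p ↦ hF.horProj p (X p)) := by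
  intro p
  rw [contMDiffAt_section]
  have hX' : ContMDiffAt 𝓘(ℝ, E) 𝓘(ℝ, E) ∞ (coordField X p) p := (contMDiffAt_section _).1 (hX p)
  have hA := contMDiffAt_coordDifferential hF.contMDiff p
  have hGN : ContMDiffAt 𝓘(ℝ, E) 𝓘(ℝ, E' →L[ℝ] E' →L[ℝ] ℝ) ∞
      (fun q ↦ gN.coordMetric (F p) (F q)) p :=
    (gN.contMDiffAt_coordMetric (F p)).comp p (hF.contMDiff p)
  have hl := (hGN.clm_apply (hA.clm_apply hX')).clm_comp hA
  -- In coordinates `ℋX` is the inverse of the metric applied to the covector `g_N(F_* X, F_* ·)`.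
  -- Inversion of operators is smooth at an invertible one.
  have hinv : ContMDiffAt 𝓘(ℝ, E) 𝓘(ℝ, (E →L[ℝ] ℝ) →L[ℝ] E) ∞
      (fun q ↦ (gM.coordMetric p q).inverse) p := by
    obtain ⟨e, he⟩ := gM.isInvertible_modelVal p
    have h : ContDiffAt ℝ ∞ ContinuousLinearMap.inverse (gM.coordMetric p p) := by
      rw [gM.coordMetric_self, ← he]
      exact contDiffAt_map_inverse e
    exact h.contMDiffAt.comp p (gM.contMDiffAt_coordMetric p)
  refine (hinv.clm_apply hl).congr_of_eventuallyEq ?_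
  filter_upwards [baseSet_mem_nhds (E := E) p, gM.eventually_isInvertible_coordMetric p,
    hF.contMDiff.continuous.continuousAt (baseSet_mem_nhds (E := E') (F p))] with q hq hi hq'
  have h : gM.coordMetric p q (coordField (fun p ↦ hF.horProj p (X p)) p q) =
      (gN.coordMetric (F p) (F q) (coordDifferential F p q (coordField X p q))).comp
        (coordDifferential F p q) := by
    ext u
    rw [ContinuousLinearMap.comp_apply, val_mfderiv_eq_coordMetric gN F _ _ hq',
      SemiRiemannianMetric.coordMetric_apply, symmL_coordField _ hq, symmL_coordField _ hq,
      hF.val_horProj]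
  obtain ⟨e, he⟩ := hi
  change coordField (fun p ↦ hF.horProj p (X p)) p q = _
  rw [← h, ← he, ContinuousLinearMap.inverse_equiv]
  simp

lemma isSmoothField_vertProj {X : Π p : M, TangentSpace 𝓘(ℝ, E) p} (hX : IsSmoothField X) :
    IsSmoothField (fun p ↦ hF.vertProj p (X p)) := by
  have h : (fun p ↦ hF.vertProj p (X p)) = X - fun p ↦ hF.horProj p (X p) := by
    funext p
    exact eq_sub_of_add_eq (hF.vertProj_add_horProj p (X p))
  rw [h]
  exact hX.sub_section (hF.isSmoothField_horProj hX)

end IsSemiRiemannianSubmersion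

end Submersion

/-! ### Vertical fields preserve the horizontal metric -/

section SubmersionBracket

variable {E : Type*} [NormedAddCommGroup E] [NormedSpace ℝ E] [FiniteDimensional ℝ E]
  {M : Type*} [TopologicalSpace M] [ChartedSpace E M] [IsManifold 𝓘(ℝ, E) ∞ M]
  {E' : Type*} [NormedAddCommGroup E'] [NormedSpace ℝ E'] [FiniteDimensional ℝ E']
  {N : Type*} [TopologicalSpace N] [ChartedSpace E' N] [IsManifold 𝓘(ℝ, E') ∞ N]

/-- The local representative of `F` in the preferred charts at `p` and `F p`. -/
def chartRep (F : M → N) (p : M) (y : E) : E' :=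
  extChartAt 𝓘(ℝ, E') (F p) (F ((extChartAt 𝓘(ℝ, E) p).symm y))

lemma contDiffAt_chartRep {F : M → N} (hF : ContMDiff 𝓘(ℝ, E) 𝓘(ℝ, E') ∞ F) (p : M) :
    ContDiffAt ℝ ∞ (chartRep (E := E) (E' := E') F p) (extChartAt 𝓘(ℝ, E) p p) := by
  have h := (contMDiffAt_iff.1 (hF p)).2
  rwa [modelWithCornersSelf_coe, Set.range_id, contDiffWithinAt_univ] at h

lemma hasFDerivAt_comp_of_hasMFDerivAt {f : E → M} {h : M → E'} {x : E} {q : M}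
    {f' : E →L[ℝ] E} {h' : E →L[ℝ] E'} (hh : HasMFDerivAt 𝓘(ℝ, E) 𝓘(ℝ, E') h q h')
    (hf : HasMFDerivAt 𝓘(ℝ, E) 𝓘(ℝ, E) f x f') (hq : f x = q) :
    HasFDerivAt (h ∘ f) (h'.comp f') x := by
  subst hq
  exact (HasMFDerivAt.comp x hh hf).hasFDerivAt

/-- The chain rule in charts that stay fixed while `q` varies. The formula is needed at all `q` near
`p`, since the differential of `F` is itself going to be differentiated. -/
lemma hasFDerivAt_chartRep {F : M → N} (hF : ContMDiff 𝓘(ℝ, E) 𝓘(ℝ, E') ∞ F) {p q : M}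
    (hq : q ∈ (chartAt E p).source) (hq' : F q ∈ (chartAt E' (F p)).source) :
    HasFDerivAt (chartRep (E := E) (E' := E') F p) (coordDifferential F p q)
      (extChartAt 𝓘(ℝ, E) p q) := by
  have hqs : q ∈ (extChartAt 𝓘(ℝ, E) p).source := by rwa [extChartAt_source]
  have h1 : HasMFDerivAt 𝓘(ℝ, E) 𝓘(ℝ, E) (extChartAt 𝓘(ℝ, E) p).symm (extChartAt 𝓘(ℝ, E) p q)
      (mfderivWithin 𝓘(ℝ, E) 𝓘(ℝ, E) (extChartAt 𝓘(ℝ, E) p).symm (Set.range 𝓘(ℝ, E))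
        (extChartAt 𝓘(ℝ, E) p q)) := by
    rw [← hasMFDerivWithinAt_univ]
    have h := (mdifferentiableWithinAt_extChartAt_symm (I := 𝓘(ℝ, E))
      ((extChartAt 𝓘(ℝ, E) p).map_source hqs)).hasMFDerivWithinAt
    have hr : Set.range 𝓘(ℝ, E) = Set.univ := by simp
    exact hr ▸ h
  have h2 := (hF.mdifferentiableAt (x := q) (by simp)).hasMFDerivAt
  have h3 := (mdifferentiableAt_extChartAt (I := 𝓘(ℝ, E')) hq').hasMFDerivAt
  have h4 := hasFDerivAt_comp_of_hasMFDerivAt (h3.comp q h2) h1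
    ((extChartAt 𝓘(ℝ, E) p).left_inv hqs)
  have h5 := inTangentCoordinates_eq_mfderiv_comp (I := 𝓘(ℝ, E)) (I' := 𝓘(ℝ, E')) (f := id)
    (g := F) (ϕ := mfderiv 𝓘(ℝ, E) 𝓘(ℝ, E') F) (x₀ := p) hq hq'
  unfold coordDifferential
  rw [h5]
  exact h4

/-- If `v` lies in the kernel of `dψ` along the vector field, the derivative of `dψ(x)` in the
direction `v` is `dψ([v, x])`. -/
lemma hasFDerivAt_fderiv_apply_of_ker {ψ : E → E'} {x v : E → E} {x' v' : E →L[ℝ] E} {y : E}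
    (hψ : ContDiffAt ℝ ∞ ψ y) (hx : HasFDerivAt x x' y) (hv : HasFDerivAt v v' y)
    (hker : ∀ᶠ z in nhds y, fderiv ℝ ψ z (v z) = 0) :
    ∃ L : E →L[ℝ] E', HasFDerivAt (fun z ↦ fderiv ℝ ψ z (x z)) L y ∧
      L (v y) = fderiv ℝ ψ y (x' (v y) - v' (x y)) := by
  have hd : HasFDerivAt (fderiv ℝ ψ) (fderiv ℝ (fderiv ℝ ψ) y) y :=
    ((hψ.fderiv_right (m := ∞) (by simp)).differentiableAt
      (by simp)).hasFDerivAt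
  have hsymm : IsSymmSndFDerivAt ℝ ψ y := hψ.isSymmSndFDerivAt (by
    rw [minSmoothness_of_isRCLikeNormedField]
    exact WithTop.coe_le_coe.2 (le_top : (2 : ℕ∞) ≤ ⊤))
  -- Differentiating `dψ(v) = 0` in the direction `x` gives `D²ψ(x, v) = -dψ(v'(x))`. By symmetry of
  -- `D²ψ` this replaces the second-order term in the derivative of `dψ(x)` along `v`.
  have h0 := (hd.clm_apply hv).unique
    ((hasFDerivAt_const (0 : E') y).congr_of_eventuallyEq hker)
  have h1 := DFunLike.congr_fun h0 (x y)
  refine ⟨_, hd.clm_apply hx, ?_⟩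
  simp only [add_apply, ContinuousLinearMap.comp_apply, ContinuousLinearMap.flip_apply,
    zero_apply] at h1 ⊢
  rw [map_sub, eq_neg_of_add_eq_zero_left h1, hsymm.eq (v y) (x y)]
  abel

lemma apply_add_apply_of_eq_zero {K : E →L[ℝ] E' →L[ℝ] E' →L[ℝ] ℝ} {G : E' →L[ℝ] E' →L[ℝ] ℝ}
    {L : E →L[ℝ] E'} {s : E'} {v : E} (hK : K v = 0) :
    (G s ∘L L + (G ∘L L + K.flip s).flip s) v = G s (L v) + G (L v) s := by
  simp [hK]

namespace IsSemiRiemannianSubmersion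

variable {gM : SemiRiemannianMetric E M} {gN : SemiRiemannianMetric E' N} {F : M → N}
  (hF : IsSemiRiemannianSubmersion gM gN F)

include hF

/-- A vertical field `V` preserves the metric on horizontal fields:
`V g(X, X) = 2 g([V, X], X)`. -/
lemma val_leviCivita_eq_val_mlieBracket {X V : Π p : M, TangentSpace 𝓘(ℝ, E) p}
    (hX : IsSectionOf (horizontal (E' := E') gM F) X)
    (hV : IsSectionOf (vertical (E := E) (E' := E') F) V) (p : M) :
    gM.val p (gM.leviCivita X p (V p)) (X p) = gM.val p (mlieBracket 𝓘(ℝ, E) V X p) (X p) := by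
  set y := extChartAt 𝓘(ℝ, E) p p with hy
  have hXd := hasFDerivAt_comp_extChartAt_symm
    (mdifferentiableAt_coordField (hX.1.mdifferentiableAt p))
  have hVd := hasFDerivAt_comp_extChartAt_symm
    (mdifferentiableAt_coordField (hV.1.mdifferentiableAt p))
  have hFs : ∀ᶠ q in nhds p, F q ∈ (trivializationAt E' (TangentSpace 𝓘(ℝ, E')) (F p)).baseSet :=
    hF.contMDiff.continuous.continuousAt (baseSet_mem_nhds (E := E') (F p))
  have hd : ∀ᶠ z in nhds y, fderiv ℝ (chartRep (E := E) (E' := E') F p) z =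
      coordDifferential F p ((extChartAt 𝓘(ℝ, E) p).symm z) := by
    filter_upwards [extChartAt_target_mem_nhds (I := 𝓘(ℝ, E)) p,
      (tendsto_extChartAt_symm (E := E) p).eventually hFs] with z hz hz'
    have hz'' := (extChartAt 𝓘(ℝ, E) p).map_target hz
    rw [extChartAt_source] at hz''
    have h := hasFDerivAt_chartRep hF.contMDiff hz'' hz'
    rw [(extChartAt 𝓘(ℝ, E) p).right_inv hz] at h
    exact h.fderiv
  have hker : ∀ᶠ z in nhds y, fderiv ℝ (chartRep (E := E) (E' := E') F p) z
      (coordField V p ((extChartAt 𝓘(ℝ, E) p).symm z)) = 0 := by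
    filter_upwards [hd, (tendsto_extChartAt_symm (E := E) p).eventually hFs,
      tendsto_extChartAt_symm p (baseSet_mem_nhds (E := E) p)] with z hz hz' hz''
    have h0 : mfderiv 𝓘(ℝ, E) 𝓘(ℝ, E') F ((extChartAt 𝓘(ℝ, E) p).symm z)
      (V ((extChartAt 𝓘(ℝ, E) p).symm z)) = 0 := hV.2 _
    rw [hz, coordDifferential_coordField F V hz'' hz', h0]
    exact congrArg Prod.snd ((trivializationAt E' (TangentSpace 𝓘(ℝ, E')) (F p)).zeroSection ℝ hz')
  obtain ⟨L, hL, hLv⟩ := hasFDerivAt_fderiv_apply_of_ker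
    (contDiffAt_chartRep hF.contMDiff p) hXd hVd hker
  have hL' : HasFDerivAt (fun z ↦ coordDifferential (E' := E') F p ((extChartAt 𝓘(ℝ, E) p).symm z)
      (coordField X p ((extChartAt 𝓘(ℝ, E) p).symm z))) L y := by
    refine hL.congr_of_eventuallyEq ?_
    filter_upwards [hd] with z hz
    rw [hz]
  have hR : HasFDerivAt (chartRep (E := E) (E' := E') F p) (coordDifferential F p p) y :=
    hasFDerivAt_chartRep hF.contMDiff (mem_chart_source E p) (mem_chart_source E' (F p))
  have hG : HasFDerivAt (fun z ↦ gN.coordMetric (F p) (F ((extChartAt 𝓘(ℝ, E) p).symm z)))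
      ((gN.coordMetricDeriv (F p)).comp (coordDifferential F p p)) y := by
    have e : extChartAt 𝓘(ℝ, E') (F p) (F p) = chartRep (E := E) (E' := E') F p y := by
      simp [chartRep, hy]
    have h := gN.hasFDerivAt_coordMetric (F p)
    rw [e] at h
    refine (h.comp y hR).congr_of_eventuallyEq ?_
    filter_upwards [(tendsto_extChartAt_symm (E := E) p).eventually hFs] with z hz
    have hz' : F ((extChartAt 𝓘(ℝ, E) p).symm z) ∈ (extChartAt 𝓘(ℝ, E') (F p)).source := by
      rw [extChartAt_source]
      exact hz
    rw [Function.comp_apply, chartRep, (extChartAt 𝓘(ℝ, E') (F p)).left_inv hz']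
  -- Since `F_* V = 0`, the coefficients of `g_N` along `F` have zero derivative in the direction
  -- `V`.
  have hGV : ((gN.coordMetricDeriv (F p)).comp (coordDifferential (E := E) F p p)) (V p) = 0 := by
    have h0 : coordDifferential (E := E) (E' := E') F p p (V p) = 0 :=
      (coordDifferential_self (E := E) (E' := E') F p (V p)).trans (hV.2 p)
    exact (congrArg (gN.coordMetricDeriv (F p)) h0).trans (map_zero _)
  obtain ⟨K, hK, hKv⟩ := gM.exists_hasFDerivAt_val (hX.1.mdifferentiableAt p)
    (hX.1.mdifferentiableAt p)
  -- The function `g_M(X, X) = g_N(F_* X, F_* X)` is differentiated twice over: upstairs with the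
  -- metric connection, downstairs with the product rule. Comparing the two derivatives in the
  -- direction `V` gives the claim.
  have hK' := ((hG.clm_apply hL').clm_apply hL').congr_of_eventuallyEq (f₁ := fun z ↦
    gM.val ((extChartAt 𝓘(ℝ, E) p).symm z) (X ((extChartAt 𝓘(ℝ, E) p).symm z))
      (X ((extChartAt 𝓘(ℝ, E) p).symm z))) (by
    filter_upwards [(tendsto_extChartAt_symm (E := E) p).eventually hFs,
      tendsto_extChartAt_symm p (baseSet_mem_nhds (E := E) p)] with z hz' hz''
    rw [val_mfderiv_eq_coordMetric gN F _ _ hz', symmL_coordField X hz'',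
      hF.isometry _ _ _ (hX.2 _) (hX.2 _)])
  have h1 := hKv (V p)
  rw [hK.unique hK', gM.symm p (X p), hy, extChartAt_to_inv, coordField_self] at h1
  have h2 := (apply_add_apply_of_eq_zero hGV).symm.trans h1
  rw [extChartAt_to_inv, coordField_self, coordField_self, ← hy, hR.fderiv] at hLv
  have h3 : L (V p) = mfderiv 𝓘(ℝ, E) 𝓘(ℝ, E') F p (mlieBracket 𝓘(ℝ, E) V X p) := by
    rw [mlieBracket_eq_coordFieldDeriv (hV.1.mdifferentiableAt p) (hX.1.mdifferentiableAt p)]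
    exact hLv.trans (coordDifferential_self (E := E) (E' := E') F p _)
  have h4 : gN.coordMetric (F p) (F p) (L (V p)) (coordDifferential (E := E) F p p (X p)) =
      gM.val p (mlieBracket 𝓘(ℝ, E) V X p) (X p) := by
    have e := hF.val_horProj p (X p) (mlieBracket 𝓘(ℝ, E) V X p)
    rw [hF.horProj_of_mem (hX.2 p)] at e
    rw [gM.symm, e, gN.symm, gN.coordMetric_self]
    exact congrArg₂ (fun a b ↦ gN.modelVal (F p) a b) h3 (coordDifferential_self (E := E) (E' := E') F p (X p))
  have h5 : gN.coordMetric (F p) (F p) (coordDifferential (E := E) F p p (X p)) (L (V p)) =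
      gM.val p (mlieBracket 𝓘(ℝ, E) V X p) (X p) := by
    rw [← h4, gN.coordMetric_self, gN.modelVal_symm]
  linarith

end IsSemiRiemannianSubmersion

end SubmersionBracket

/-! ### Definiteness of horizontal vectors, the tensor `A` and the second fundamental form -/

section TensorA

variable {E : Type*} [NormedAddCommGroup E] [NormedSpace ℝ E] [FiniteDimensional ℝ E]
  {M : Type*} [TopologicalSpace M] [ChartedSpace E M] [IsManifold 𝓘(ℝ, E) ∞ M]
  {E' : Type*} [NormedAddCommGroup E'] [NormedSpace ℝ E'] [FiniteDimensional ℝ E']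
  {N : Type*} [TopologicalSpace N] [ChartedSpace E' N] [IsManifold 𝓘(ℝ, E') ∞ N]

lemma SemiRiemannianMetric.leviCivita_zero (g : SemiRiemannianMetric E M) (p : M)
    (v : TangentSpace 𝓘(ℝ, E) p) : g.leviCivita (fun _ ↦ 0) p v = 0 := by
  have h : g.leviCivita (fun _ ↦ 0) p = 0 :=
    congrFun g.leviCivita.zero p
  rw [h]
  rfl

/-- A vector of negative square would span a negative definite line, so the index would be at least
one. -/
lemma SemiRiemannianMetric.val_self_nonneg {g : SemiRiemannianMetric E M} (hg : g.IsRiemannian)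
    (p : M) (v : TangentSpace 𝓘(ℝ, E) p) : 0 ≤ g.val p v v := by
  by_contra! hv
  have hv0 : v ≠ 0 := by
    rintro rfl
    simp at hv
  have h := (g.isGreatest_index p).2 ⟨Submodule.span ℝ {v}, finrank_span_singleton hv0, ?_⟩
  · rw [hg] at h
    omega
  · intro w hw hw0
    obtain ⟨c, rfl⟩ := Submodule.mem_span_singleton.1 hw
    have hc : c ≠ 0 := by
      rintro rfl
      simp at hw0
    have h1 : g.val p (c • v) (c • v) = c * c * g.val p v v := by
      rw [map_smul, map_smul, smul_apply, smul_eq_mul, smul_eq_mul, mul_assoc]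
    rw [h1]
    exact mul_neg_of_pos_of_neg (mul_self_pos.2 hc) hv

/-- Index zero gives only semidefiniteness directly. The nonnegative quadratic `t ↦ g(v + tw, v +
tw)` has no constant term, so its discriminant forces `g(v, w) = 0` for every `w`, and nondegeneracy
applies. -/
lemma SemiRiemannianMetric.eq_zero_of_val_self {g : SemiRiemannianMetric E M}
    (hg : g.IsRiemannian) (p : M) {v : TangentSpace 𝓘(ℝ, E) p} (hv : g.val p v v = 0) :
    v = 0 := by
  refine g.nondegenerate p v fun w ↦ ?_
  have h : ∀ t : ℝ, 0 ≤ g.val p w w * (t * t) + 2 * g.val p v w * t + 0 := fun t ↦ by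
    have h1 := val_self_nonneg hg p (v + t • w)
    have h2 : g.val p (v + t • w) (v + t • w) =
        g.val p w w * (t * t) + 2 * g.val p v w * t + 0 := by
      simp only [map_add, map_smul, add_apply, smul_apply, smul_eq_mul, hv, g.symm p w v]
      ring
    rwa [h2] at h1
  have h3 := discrim_le_zero h
  rw [discrim] at h3
  nlinarith [sq_nonneg (g.val p v w)]

namespace IsSemiRiemannianSubmersion

variable {gM : SemiRiemannianMetric E M} {gN : SemiRiemannianMetric E' N} {F : M → N}
  (hF : IsSemiRiemannianSubmersion gM gN F)

include hF

lemma eq_zero_of_mem_horizontal (hN : gN.IsRiemannian) {p : M} {x : TangentSpace 𝓘(ℝ, E) p}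
    (hx : x ∈ horizontal (E' := E') gM F p) (h : gM.val p x x = 0) : x = 0 := by
  rw [← hF.isometry p x x hx hx] at h
  exact Submodule.disjoint_def.1 (hF.isCompl p).disjoint x
    (SemiRiemannianMetric.eq_zero_of_val_self hN _ h) hx

lemma val_horProj_left {p : M} (x : TangentSpace 𝓘(ℝ, E) p) {y : TangentSpace 𝓘(ℝ, E) p}
    (hy : y ∈ horizontal (E' := E') gM F p) : gM.val p (hF.horProj p x) y = gM.val p x y := by
  conv_rhs => rw [← hF.vertProj_add_horProj p x, map_add, add_apply,
    hF.val_eq_zero p (hF.vertProj_mem p x) hy, zero_add]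

lemma tensorA_of_vertical {X W : Π p : M, TangentSpace 𝓘(ℝ, E) p}
    (hX : ∀ p, X p ∈ horizontal (E' := E') gM F p)
    (hW : ∀ p, W p ∈ vertical (E := E) (E' := E') F p) (p : M) :
    hF.tensorA X W p = hF.horProj p (gM.leviCivita W p (X p)) := by
  have h1 : (fun q ↦ hF.horProj q (W q)) = fun _ ↦ 0 :=
    funext fun q ↦ hF.horProj_of_mem_vertical (hW q)
  have h2 : (fun q ↦ hF.vertProj q (W q)) = W := funext fun q ↦ hF.vertProj_of_mem (hW q)
  rw [tensorA, h1, h2, hF.horProj_of_mem (hX p), gM.leviCivita_zero, map_zero, zero_add]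

/-- The section `F_* W` is identically zero, so its pullback derivative vanishes. -/
lemma secondFundamentalForm_of_vertical {X W : Π p : M, TangentSpace 𝓘(ℝ, E) p}
    (hW : ∀ p, W p ∈ vertical (E := E) (E' := E') F p) (p : M) :
    secondFundamentalForm gM gN F X W p =
      -mfderiv 𝓘(ℝ, E) 𝓘(ℝ, E') F p (gM.leviCivita W p (X p)) := by
  have h0 : (fun q ↦ mfderiv 𝓘(ℝ, E) 𝓘(ℝ, E') F q (W q)) = fun _ ↦ 0 := funext fun q ↦ hW q
  have h1 : (fun q ↦ (trivializationAt E' (TangentSpace 𝓘(ℝ, E')) (F p)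
      ⟨F q, (0 : TangentSpace 𝓘(ℝ, E') (F q))⟩).2) =ᶠ[nhds p] fun _ ↦ (0 : E') := by
    filter_upwards [hF.contMDiff.continuous.continuousAt
      (baseSet_mem_nhds (E := E') (F p))] with q hq
    exact congrArg Prod.snd
      ((trivializationAt E' (TangentSpace 𝓘(ℝ, E')) (F p)).zeroSection ℝ hq)
  have h2 : mfderiv 𝓘(ℝ, E) 𝓘(ℝ, E') (fun q ↦ (trivializationAt E' (TangentSpace 𝓘(ℝ, E')) (F p)
      ⟨F q, (0 : TangentSpace 𝓘(ℝ, E') (F q))⟩).2) p (X p) = (0 : E') := by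
    have h := h1.mfderiv_eq (I := 𝓘(ℝ, E)) (I' := 𝓘(ℝ, E'))
    rw [mfderiv_const] at h
    exact DFunLike.congr_fun h (X p)
  have h3 : pullbackConnection gN F (fun q ↦ (0 : TangentSpace 𝓘(ℝ, E') (F q))) p (X p) = 0 := by
    have h4 : gN.christoffel (F p) (mfderiv 𝓘(ℝ, E) 𝓘(ℝ, E') F p (X p)) (0 : E') = 0 :=
      map_zero _
    exact (congrArg₂ (fun a b : E' ↦ a + b) h2 h4).trans (add_zero _)
  rw [secondFundamentalForm, h0, h3, zero_sub]

/-- `g_N((∇F_*)(X, W), F_* Z) = -g_M(A_X W, Z)` for `X`, `Z` horizontal and `W` vertical. -/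
lemma val_secondFundamentalForm {X W : Π p : M, TangentSpace 𝓘(ℝ, E) p}
    (hX : ∀ p, X p ∈ horizontal (E' := E') gM F p)
    (hW : ∀ p, W p ∈ vertical (E := E) (E' := E') F p) (p : M) (z : TangentSpace 𝓘(ℝ, E) p) :
    gN.val (F p) (secondFundamentalForm gM gN F X W p) (mfderiv 𝓘(ℝ, E) 𝓘(ℝ, E') F p z) =
      -gM.val p (hF.tensorA X W p) z := by
  rw [hF.secondFundamentalForm_of_vertical hW, hF.tensorA_of_vertical hX hW, hF.val_horProj,
    map_neg, neg_apply]

end IsSemiRiemannianSubmersion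

end TensorA

/-! ### Algebra of the almost (para)contact structure and the derivative of `ξ` -/

section Contact

variable {E : Type*} [NormedAddCommGroup E] [NormedSpace ℝ E] [FiniteDimensional ℝ E]
  {M : Type*} [TopologicalSpace M] [ChartedSpace E M] [IsManifold 𝓘(ℝ, E) ∞ M]
  {E' : Type*} [NormedAddCommGroup E'] [NormedSpace ℝ E'] [FiniteDimensional ℝ E']
  {N : Type*} [TopologicalSpace N] [ChartedSpace E' N] [IsManifold 𝓘(ℝ, E') ∞ N]

namespace AlmostContactStructure

variable {g : SemiRiemannianMetric E M} {ε : ℝ} (S : AlmostContactStructure g ε)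

include S

lemma mul_self_sign : ε * ε = 1 := by
  rcases S.sign with h | h <;> rw [h] <;> norm_num

lemma sign_ne_zero : ε ≠ 0 := by
  rcases S.sign with h | h <;> rw [h] <;> norm_num

lemma xi_ne_zero (p : M) : S.xi p ≠ 0 := fun h ↦ by
  have h1 := S.eta_xi p
  rw [h, map_zero] at h1
  exact S.sign_ne_zero (by linarith)

lemma val_xi_xi (p : M) : g.val p (S.xi p) (S.xi p) = -1 := by
  have h := S.eta_eq p (S.xi p)
  rw [S.eta_xi] at h
  exact mul_left_cancel₀ S.sign_ne_zero (by linarith)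

/-- The axioms give `φ²ξ = 0`. For `w = φξ` this means `0 = φ²w = εw + η(w)ξ`; applying `φ` once
more leaves `η(w)w = 0`, and either factor being zero gives `w = 0`. -/
lemma phi_xi (p : M) : S.phi p (S.xi p) = 0 := by
  have h1 : S.phi p (S.phi p (S.xi p)) = 0 := by
    rw [S.phi_phi, S.eta_xi, neg_smul, add_neg_cancel]
  set w := S.phi p (S.xi p) with hw
  have h2 : ε • w + S.eta p w • S.xi p = 0 := by
    rw [← S.phi_phi, h1, map_zero]
  have h3 : S.eta p w • w = 0 := by
    have h := congrArg (S.phi p) h2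
    rwa [map_add, map_smul, map_smul, h1, smul_zero, zero_add, map_zero] at h
  rcases smul_eq_zero.1 h3 with h | h
  · rw [h, zero_smul, add_zero] at h2
    exact (smul_eq_zero.1 h2).resolve_left S.sign_ne_zero
  · exact h

/-- Computing `φ³x` as `φ(φ²x)` and as `φ²(φx)` gives `η(φx)ξ = 0`. -/
lemma eta_phi (p : M) (x : TangentSpace 𝓘(ℝ, E) p) : S.eta p (S.phi p x) = 0 := by
  have h := congrArg (S.phi p) (S.phi_phi p x)
  rw [S.phi_phi, map_add, map_smul, map_smul, S.phi_xi, smul_zero, add_zero,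
    add_eq_left] at h
  exact (smul_eq_zero.1 h).resolve_right (S.xi_ne_zero p)

lemma val_xi_eq_zero_iff (p : M) (x : TangentSpace 𝓘(ℝ, E) p) :
    g.val p x (S.xi p) = 0 ↔ S.eta p x = 0 := by
  rw [S.eta_eq, mul_eq_zero, or_iff_right S.sign_ne_zero]

lemma val_phi_xi (p : M) (x : TangentSpace 𝓘(ℝ, E) p) : g.val p (S.phi p x) (S.xi p) = 0 :=
  (S.val_xi_eq_zero_iff p _).2 (S.eta_phi p x)

/-- Compatibility of `φ` with the metric, applied to `φx` and `y`. Thus `φ` is symmetric for `ε = 1`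
and skew for `ε = -1`, which is the source of the two cases below. -/
lemma val_phi_left (p : M) (x y : TangentSpace 𝓘(ℝ, E) p) :
    g.val p (S.phi p x) y = ε * g.val p x (S.phi p y) := by
  have h := S.val_phi_phi p (S.phi p x) y
  rw [S.eta_phi, zero_mul, add_zero, S.phi_phi, map_add, map_smul, map_smul, add_apply,
    smul_apply, smul_apply, g.symm p (S.xi p), S.val_phi_xi, smul_zero, add_zero] at h
  exact h.symm

lemma isSmoothField_phiField {X : Π p : M, TangentSpace 𝓘(ℝ, E) p} (hX : IsSmoothField X) :
    IsSmoothField (S.phiField X) :=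
  S.contMDiff_phi.clm_bundle_apply hX

/-- The two sign conventions for a Sasakian structure, in one formula. -/
lemma exists_covDerivPhi_eq (hS : S.IsSasakian) :
    ∃ a : ℝ, a * a = 1 ∧ ∀ X Y : Π p : M, TangentSpace 𝓘(ℝ, E) p,
      IsSmoothField X → IsSmoothField Y → ∀ p, S.covDerivPhi X Y p =
        (a * g.val p (S.phi p (X p)) (S.phi p (Y p))) • S.xi p +
          (ε * a * S.eta p (Y p)) • S.phi p (S.phi p (X p)) := by
  rcases hS with h | h
  · refine ⟨ε, S.mul_self_sign, fun X Y hX hY p ↦ ?_⟩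
    rw [h X Y hX hY p, S.mul_self_sign, one_mul]
  · refine ⟨1, one_mul 1, fun X Y hX hY p ↦ ?_⟩
    rw [h X Y hX hY p, mul_one, one_mul]

variable {a : ℝ}

/-- `∇_X ξ = a φ X`. -/
lemma leviCivita_xi
    (ha : ∀ X Y : Π p : M, TangentSpace 𝓘(ℝ, E) p, IsSmoothField X → IsSmoothField Y → ∀ p,
      S.covDerivPhi X Y p = (a * g.val p (S.phi p (X p)) (S.phi p (Y p))) • S.xi p +
        (ε * a * S.eta p (Y p)) • S.phi p (S.phi p (X p)))
    {X : Π p : M, TangentSpace 𝓘(ℝ, E) p} (hX : IsSmoothField X) (p : M) :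
    g.leviCivita S.xi p (X p) = a • S.phi p (X p) := by
  have h1 := ha X S.xi hX S.contMDiff_xi p
  have h2 : S.phiField S.xi = fun _ ↦ 0 := funext S.phi_xi
  rw [covDerivPhi, h2, g.leviCivita_zero, zero_sub, S.phi_xi, map_zero, mul_zero, zero_smul,
    zero_add, S.eta_xi] at h1
  have h3 : ε * a * -ε = -a := by linear_combination -a * S.mul_self_sign
  rw [h3, neg_smul, neg_inj, ← map_smul] at h1
  set z := g.leviCivita S.xi p (X p) with hz
  -- The structure equation at `Y = ξ` determines `∇_X ξ` only up to the kernel of `φ`. The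
  -- constancy of `g(ξ, ξ) = -1` supplies the missing component, and `φ² = ε + η ⊗ ξ` then shows
  -- that the difference from `a φX` is zero.
  have h4 : g.val p z (S.xi p) = 0 := by
    have h := g.val_leviCivita_add_of_const (S.contMDiff_xi.mdifferentiableAt p)
      (S.contMDiff_xi.mdifferentiableAt p) S.val_xi_xi (X p)
    rw [g.symm p (S.xi p), ← hz] at h
    linarith
  have h5 : S.phi p (z - a • S.phi p (X p)) = 0 := by rw [map_sub, h1, sub_self]
  have h6 : S.eta p (z - a • S.phi p (X p)) = 0 := by
    rw [map_sub, map_smul, S.eta_phi, smul_zero, sub_zero]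
    exact (S.val_xi_eq_zero_iff p _).1 h4
  have h7 := S.phi_phi p (z - a • S.phi p (X p))
  rw [h5, map_zero, h6, zero_smul, add_zero] at h7
  exact sub_eq_zero.1 ((smul_eq_zero.1 h7.symm).resolve_left S.sign_ne_zero)

end AlmostContactStructure
end Contact

/-! ### Vanishing of `C` and brackets of horizontal fields -/

section AntiInvariant

variable {E : Type*} [NormedAddCommGroup E] [NormedSpace ℝ E] [FiniteDimensional ℝ E]
  {M : Type*} [TopologicalSpace M] [ChartedSpace E M] [IsManifold 𝓘(ℝ, E) ∞ M]
  {E' : Type*} [NormedAddCommGroup E'] [NormedSpace ℝ E'] [FiniteDimensional ℝ E']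
  {N : Type*} [TopologicalSpace N] [ChartedSpace E' N] [IsManifold 𝓘(ℝ, E') ∞ N]

lemma isSmoothField_mlieBracket {X Y : Π p : M, TangentSpace 𝓘(ℝ, E) p} (hX : IsSmoothField X)
    (hY : IsSmoothField Y) : IsSmoothField (mlieBracket 𝓘(ℝ, E) X Y) := by
  intro p
  have : IsManifold 𝓘(ℝ, E) (((⊤ : ℕ∞) : WithTop ℕ∞) + 1) M :=
    inferInstanceAs (IsManifold 𝓘(ℝ, E) ∞ M)
  have : IsManifold 𝓘(ℝ, E) (minSmoothness ℝ 2) M := by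
    rw [minSmoothness_of_isRCLikeNormedField]
    infer_instance
  have : IsManifold 𝓘(ℝ, E) (minSmoothness ℝ 3) M := by
    rw [minSmoothness_of_isRCLikeNormedField]
    infer_instance
  exact ContMDiffAt.mlieBracket_vectorField (m := ⊤) (n := ⊤) (hX p) (hY p) (by simp)

lemma IsSectionOf.add {D : Π p : M, Submodule ℝ (TangentSpace 𝓘(ℝ, E) p)}
    {X Y : Π p : M, TangentSpace 𝓘(ℝ, E) p} (hX : IsSectionOf D X) (hY : IsSectionOf D Y) :
    IsSectionOf D (X + Y) :=
  ⟨hX.1.add_section hY.1, fun p ↦ (D p).add_mem (hX.2 p) (hY.2 p)⟩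

namespace AlmostContactStructure

variable {gM : SemiRiemannianMetric E M} {gN : SemiRiemannianMetric E' N} {F : M → N} {ε a : ℝ}
  (S : AlmostContactStructure gM ε) (hF : IsSemiRiemannianSubmersion gM gN F)

/-- The field `C X`, the horizontal part of `φ X`. -/
def fieldC (X : Π p : M, TangentSpace 𝓘(ℝ, E) p) (p : M) : TangentSpace 𝓘(ℝ, E) p :=
  hF.horProj p (S.phi p (X p))

lemma isSectionOf_fieldC {X : Π p : M, TangentSpace 𝓘(ℝ, E) p} (hX : IsSmoothField X) :
    IsSectionOf (horizontal (E' := E') gM F) (S.fieldC hF X) :=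
  ⟨hF.isSmoothField_horProj (S.isSmoothField_phiField hX), fun p ↦ hF.horProj_mem p _⟩

lemma val_fieldC {X : Π p : M, TangentSpace 𝓘(ℝ, E) p} {p : M} {y : TangentSpace 𝓘(ℝ, E) p}
    (hy : y ∈ horizontal (E' := E') gM F p) :
    gM.val p (S.fieldC hF X p) y = gM.val p (S.phi p (X p)) y :=
  hF.val_horProj_left _ hy

/-- `C = 0` if `φ` vanishes as a bilinear form on horizontal fields. -/
lemma fieldC_eq_zero_of_val (hN : gN.IsRiemannian)
    (h : ∀ X Y : Π p : M, TangentSpace 𝓘(ℝ, E) p, IsSectionOf (horizontal (E' := E') gM F) X →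
      IsSectionOf (horizontal (E' := E') gM F) Y → ∀ p, gM.val p (S.phi p (X p)) (Y p) = 0)
    {X : Π p : M, TangentSpace 𝓘(ℝ, E) p} (hX : IsSectionOf (horizontal (E' := E') gM F) X)
    (p : M) : S.fieldC hF X p = 0 := by
  have hC := S.isSectionOf_fieldC hF hX.1
  -- The field `CX` is itself horizontal and serves as the test field: `g(CX, CX) = g(φX, CX) = 0`.
  refine hF.eq_zero_of_mem_horizontal hN (hC.2 p) ?_
  rw [S.val_fieldC hF (hC.2 p)]
  exact h X _ hX hC p

lemma eta_eq_zero_of_mem_horizontal (hxi : ∀ p, S.xi p ∈ vertical (E := E) (E' := E') F p)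
    {p : M} {x : TangentSpace 𝓘(ℝ, E) p} (hx : x ∈ horizontal (E' := E') gM F p) :
    S.eta p x = 0 := by
  refine (S.val_xi_eq_zero_iff p x).1 ?_
  rw [gM.symm]
  exact hx _ (hxi p)

section Sasakian

variable (hN : gN.IsRiemannian) (hanti : S.IsAntiInvariant (E' := E') F)
  (hxi : ∀ p, S.xi p ∈ vertical (E := E) (E' := E') F p) (haa : a * a = 1)
  (ha : ∀ X Y : Π p : M, TangentSpace 𝓘(ℝ, E) p, IsSmoothField X → IsSmoothField Y → ∀ p,
    S.covDerivPhi X Y p = (a * gM.val p (S.phi p (X p)) (S.phi p (Y p))) • S.xi p +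
      (ε * a * S.eta p (Y p)) • S.phi p (S.phi p (X p)))

include hxi ha

/-- `g(∇_X Y, ξ) = -a g(φ X, Y)` for horizontal `Y`. -/
lemma val_leviCivita_xi {X Y : Π p : M, TangentSpace 𝓘(ℝ, E) p} (hX : IsSmoothField X)
    (hY : IsSectionOf (horizontal (E' := E') gM F) Y) (p : M) :
    gM.val p (gM.leviCivita Y p (X p)) (S.xi p) = -(a * gM.val p (S.phi p (X p)) (Y p)) := by
  have h := gM.val_leviCivita_add_of_const (c := 0) (hY.1.mdifferentiableAt p)
    (S.contMDiff_xi.mdifferentiableAt p)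
    (fun q ↦ by rw [gM.symm]; exact hY.2 q _ (hxi q)) (X p)
  rw [S.leviCivita_xi ha hX p, map_smul, smul_eq_mul, gM.symm p (Y p)] at h
  linarith

/-- `g([X, Y], ξ) = (ε - 1) a g(φ X, Y)` for horizontal `X` and `Y`. -/
lemma val_mlieBracket_xi {X Y : Π p : M, TangentSpace 𝓘(ℝ, E) p}
    (hX : IsSectionOf (horizontal (E' := E') gM F) X)
    (hY : IsSectionOf (horizontal (E' := E') gM F) Y) (p : M) :
    gM.val p (mlieBracket 𝓘(ℝ, E) X Y p) (S.xi p) =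
      (ε - 1) * a * gM.val p (S.phi p (X p)) (Y p) := by
  rw [← gM.leviCivita_sub_leviCivita (hX.1.mdifferentiableAt p) (hY.1.mdifferentiableAt p),
    map_sub, sub_apply, S.val_leviCivita_xi hxi ha hX.1 hY, S.val_leviCivita_xi hxi ha hY.1 hX,
    S.val_phi_left p (Y p), gM.symm p (Y p)]
  ring

/-- The horizontal part of `∇_X ξ = a φX`. It expresses the right sides of (ii) and (iii) through
`C`. -/
lemma tensorA_xi {X : Π p : M, TangentSpace 𝓘(ℝ, E) p}
    (hX : IsSectionOf (horizontal (E' := E') gM F) X) (p : M) :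
    hF.tensorA X S.xi p = a • S.fieldC hF X p := by
  rw [hF.tensorA_of_vertical hX.2 hxi, S.leviCivita_xi ha hX.1, map_smul, fieldC]

include haa

include hF in
/-- In the para-Sasakian case `ξ` is a Killing direction for the horizontal metric, so `φ`
vanishes as a bilinear form on horizontal fields. -/
lemma val_phi_eq_zero_of_sign_eq_one (hε : ε = 1) {X Y : Π p : M, TangentSpace 𝓘(ℝ, E) p}
    (hX : IsSectionOf (horizontal (E' := E') gM F) X)
    (hY : IsSectionOf (horizontal (E' := E') gM F) Y) (p : M) :
    gM.val p (S.phi p (X p)) (Y p) = 0 := by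
  have key : ∀ Z : Π p : M, TangentSpace 𝓘(ℝ, E) p,
      IsSectionOf (horizontal (E' := E') gM F) Z → gM.val p (S.phi p (Z p)) (Z p) = 0 := by
    intro Z hZ
    have h := hF.val_leviCivita_eq_val_mlieBracket hZ ⟨S.contMDiff_xi, hxi⟩ p
    -- Since `[ξ, Z] = ∇_ξ Z - ∇_Z ξ`, the terms `g(∇_ξ Z, Z)` cancel and `g(∇_Z ξ, Z) = 0` remains.
    rw [← gM.leviCivita_sub_leviCivita (S.contMDiff_xi.mdifferentiableAt p)
      (hZ.1.mdifferentiableAt p), map_sub, sub_apply, S.leviCivita_xi ha hZ.1, map_smul,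
      smul_apply, smul_eq_mul] at h
    have h0 : a * gM.val p (S.phi p (Z p)) (Z p) = 0 := by linarith
    exact (mul_eq_zero.1 h0).resolve_left (left_ne_zero_of_mul_eq_one haa)
  -- Polarization, conclusive because `φ` is symmetric when `ε = 1`.
  have h := key (X + Y) (hX.add hY)
  have hs := S.val_phi_left p (Y p) (X p)
  rw [gM.symm p (Y p)] at hs
  rw [Pi.add_apply, map_add, map_add, map_add, add_apply, add_apply, key X hX, key Y hY, hs] at h
  linear_combination h / 2 - gM.val p (S.phi p (X p)) (Y p) / 2 * hε

include hN

/-- For `ε = -1` the `ξ`-component of the bracket is `-2a g(φX, Y)`, so integrability kills the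
form. For `ε = 1` that component carries the factor `ε - 1 = 0` and says nothing; there the
vanishing holds regardless of integrability. -/
lemma fieldC_eq_zero_of_isIntegrable (hI : IsIntegrable (horizontal (E' := E') gM F))
    {X : Π p : M, TangentSpace 𝓘(ℝ, E) p} (hX : IsSectionOf (horizontal (E' := E') gM F) X)
    (p : M) : S.fieldC hF X p = 0 := by
  refine S.fieldC_eq_zero_of_val hF hN (fun X Y hX hY p ↦ ?_) hX p
  rcases S.sign with hε | hε
  · have h := S.val_mlieBracket_xi hxi ha hX hY p
    rw [gM.symm, hF.val_eq_zero p (hxi p) (hI X Y hX hY p)] at h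
    have h0 : a * gM.val p (S.phi p (X p)) (Y p) = 0 := by
      linear_combination a * gM.val p (S.phi p (X p)) (Y p) / 2 * hε + h / 2
    exact (mul_eq_zero.1 h0).resolve_left (left_ne_zero_of_mul_eq_one haa)
  · exact S.val_phi_eq_zero_of_sign_eq_one hF hxi haa ha hε hX hY p

/-- Condition (iii) for the vertical field `ξ` forces `C = 0`. -/
lemma fieldC_eq_zero_of_tensorA
    (h : ∀ X Y : Π p : M, TangentSpace 𝓘(ℝ, E) p, IsSectionOf (horizontal (E' := E') gM F) X →
      IsSectionOf (horizontal (E' := E') gM F) Y → ∀ p,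
      ε * gM.val p (hF.tensorA X S.xi p) (S.phi p (hF.tensorA Y S.xi p))
        - ε * gM.val p (hF.tensorA Y S.xi p) (S.phi p (hF.tensorA X S.xi p)) = 0)
    {X : Π p : M, TangentSpace 𝓘(ℝ, E) p} (hX : IsSectionOf (horizontal (E' := E') gM F) X)
    (p : M) : S.fieldC hF X p = 0 := by
  rcases S.sign with hε | hε
  · have hC := S.isSectionOf_fieldC hF hX.1
    have hCC := S.isSectionOf_fieldC hF hC.1
    -- With `Y = CX` the hypothesis compares `g(CX, φC²X)` with `g(C²X, φCX) = g(C²X, C²X)`. These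
    -- are negatives of each other by skewness, so both vanish.
    have h1 := h X (S.fieldC hF X) hX hC p
    rw [S.tensorA_xi hF hxi ha hX, S.tensorA_xi hF hxi ha hC] at h1
    simp only [map_smul, smul_apply, smul_eq_mul] at h1
    have h2 := S.val_phi_left p (S.fieldC hF X p) (S.fieldC hF (S.fieldC hF X) p)
    rw [← S.val_fieldC hF (hCC.2 p)] at h2
    have h3 := S.val_phi_left p (S.fieldC hF X p) (S.fieldC hF (S.fieldC hF X) p)
    rw [gM.symm] at h3
    rw [h3, ← mul_assoc a a, ← mul_assoc a a, haa] at h1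
    have h4 : S.fieldC hF (S.fieldC hF X) p = 0 :=
      hF.eq_zero_of_mem_horizontal hN (hCC.2 p) (by
        set t := gM.val p (S.fieldC hF X p) (S.phi p (S.fieldC hF (S.fieldC hF X) p))
        linear_combination h2 + h1 / 2 + ε * t / 2 * hε)
    -- From `C²X = 0`: `g(CX, CX) = g(φX, CX) = ε g(X, φCX) = ε g(X, C²X) = 0`.
    refine hF.eq_zero_of_mem_horizontal hN (hC.2 p) ?_
    rw [S.val_fieldC hF (hC.2 p), S.val_phi_left, gM.symm, ← S.val_fieldC hF (hX.2 p), h4]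
    simp
  · exact S.fieldC_eq_zero_of_val hF hN
      (fun X Y hX hY p ↦ S.val_phi_eq_zero_of_sign_eq_one hF hxi haa ha hε hX hY p) hX p

omit haa hN

include hanti

/-- If `C = 0`, then `g(∇_X Y, V) = g(A_X B Y, φ V)`. -/
lemma val_leviCivita_of_fieldC_eq_zero
    (hC : ∀ X : Π p : M, TangentSpace 𝓘(ℝ, E) p, IsSectionOf (horizontal (E' := E') gM F) X →
      ∀ p, S.fieldC hF X p = 0) {X Y : Π p : M, TangentSpace 𝓘(ℝ, E) p}
    (hX : IsSectionOf (horizontal (E' := E') gM F) X)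
    (hY : IsSectionOf (horizontal (E' := E') gM F) Y) {p : M} {v : TangentSpace 𝓘(ℝ, E) p}
    (hv : v ∈ vertical (E := E) (E' := E') F p) :
    gM.val p (gM.leviCivita Y p (X p)) v =
      gM.val p (hF.tensorA X (S.fieldB hF Y) p) (S.phi p v) := by
  have hB : S.phiField Y = S.fieldB hF Y := funext fun q ↦ by
    have h := hF.vertProj_add_horProj q (S.phi q (Y q))
    rw [show hF.horProj q (S.phi q (Y q)) = 0 from hC Y hY q, add_zero] at h
    exact h.symm
  -- As `η(Y) = 0`, the fields `∇_X(BY)` and `φ(∇_X Y)` differ by a multiple of `ξ`, which is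
  -- orthogonal to `φv`.
  have h1 := ha X Y hX.1 hY.1 p
  rw [covDerivPhi, S.eta_eq_zero_of_mem_horizontal hxi (hY.2 p), mul_zero, zero_smul, add_zero,
    hB, sub_eq_iff_eq_add] at h1
  have h2 : gM.val p (S.phi p (X p)) (Y p) = 0 := by
    rw [← S.val_fieldC hF (hY.2 p), hC X hX p]
    simp
  -- This removes the correction `η(∇_X Y) η(v)` from `g(φ∇_X Y, φv)`; it is proportional to `g(φX,
  -- Y)`, which is zero because `C = 0`.
  have h3 : S.eta p (gM.leviCivita Y p (X p)) = 0 := by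
    rw [← S.val_xi_eq_zero_iff, S.val_leviCivita_xi hxi ha hX.1 hY, h2]
    simp
  have h4 := S.val_phi_phi p (gM.leviCivita Y p (X p)) v
  rw [h3, zero_mul, add_zero] at h4
  rw [hF.tensorA_of_vertical hX.2 (S.fieldB_mem_vertical hF Y), hF.val_horProj_left _ (hanti p v hv),
    h1, map_add, add_apply, h4, map_smul, smul_apply, gM.symm p (S.xi p), S.val_phi_xi, smul_zero,
    zero_add]

/-- If `C = 0`, then `g([X, Y], V) = g(A_X B Y - A_Y B X, φ V)`. -/
lemma val_mlieBracket_of_fieldC_eq_zero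
    (hC : ∀ X : Π p : M, TangentSpace 𝓘(ℝ, E) p, IsSectionOf (horizontal (E' := E') gM F) X →
      ∀ p, S.fieldC hF X p = 0) {X Y : Π p : M, TangentSpace 𝓘(ℝ, E) p}
    (hX : IsSectionOf (horizontal (E' := E') gM F) X)
    (hY : IsSectionOf (horizontal (E' := E') gM F) Y) {p : M} {v : TangentSpace 𝓘(ℝ, E) p}
    (hv : v ∈ vertical (E := E) (E' := E') F p) :
    gM.val p (mlieBracket 𝓘(ℝ, E) X Y p) v = gM.val p
      (hF.tensorA X (S.fieldB hF Y) p - hF.tensorA Y (S.fieldB hF X) p) (S.phi p v) := by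
  rw [← gM.leviCivita_sub_leviCivita (hX.1.mdifferentiableAt p) (hY.1.mdifferentiableAt p),
    map_sub, sub_apply, map_sub, sub_apply,
    S.val_leviCivita_of_fieldC_eq_zero hF hanti hxi ha hC hX hY hv,
    S.val_leviCivita_of_fieldC_eq_zero hF hanti hxi ha hC hY hX hv]

end Sasakian

/-- The horizontal distribution is integrable if brackets of horizontal fields are orthogonal to
vertical fields. -/
lemma isIntegrable_of_val_mlieBracket (hN : gN.IsRiemannian)
    (hF : IsSemiRiemannianSubmersion gM gN F) (hanti : S.IsAntiInvariant (E' := E') F)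
    (hxi : ∀ p, S.xi p ∈ vertical (E := E) (E' := E') F p)
    (h : ∀ X Y V : Π p : M, TangentSpace 𝓘(ℝ, E) p,
      IsSectionOf (horizontal (E' := E') gM F) X → IsSectionOf (horizontal (E' := E') gM F) Y →
      IsSectionOf (vertical (E := E) (E' := E') F) V → ∀ p,
        gM.val p (mlieBracket 𝓘(ℝ, E) X Y p) (V p) = 0) :
    IsIntegrable (horizontal (E' := E') gM F) := by
  intro X Y hX hY p
  set Z := mlieBracket 𝓘(ℝ, E) X Y with hZ
  have hsum := hF.vertProj_add_horProj p (Z p)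
  have hvert : ∀ v ∈ vertical (E := E) (E' := E') F p,
      gM.val p (Z p) v = gM.val p (hF.vertProj p (Z p)) v := fun v hv ↦ by
    conv_lhs => rw [← hsum, map_add, add_apply, gM.symm p (hF.horProj p (Z p)),
      hF.val_eq_zero p hv (hF.horProj_mem p _), add_zero]
  -- The vertical part of the bracket is a smooth vertical field, so it can be used as `V` itself
  -- and no tangent vector has to be extended to a field.
  have hU : IsSectionOf (vertical (E := E) (E' := E') F) (fun q ↦ hF.vertProj q (Z q)) :=
    ⟨hF.isSmoothField_vertProj (isSmoothField_mlieBracket hX.1 hY.1), fun q ↦ hF.vertProj_mem q _⟩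
  have h1 := h X Y _ hX hY hU p
  rw [hvert _ (hU.2 p)] at h1
  have h2 := h X Y _ hX hY ⟨S.contMDiff_xi, hxi⟩ p
  rw [hvert _ (hxi p), S.val_xi_eq_zero_iff] at h2
  -- The vertical part `U` is null, which is not enough since the fibre metric is not positive
  -- definite (`g(ξ, ξ) = -1`). But `η(U) = 0` makes `φU` null as well, and `φU` is horizontal by
  -- anti-invariance, where the metric is definite. Then `εU = φ²U = 0`.
  have h3 : S.phi p (hF.vertProj p (Z p)) = 0 := by
    refine hF.eq_zero_of_mem_horizontal hN (hanti p _ (hU.2 p)) ?_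
    rw [S.val_phi_phi, h1, h2, mul_zero, add_zero]
  have h4 := S.phi_phi p (hF.vertProj p (Z p))
  rw [h3, map_zero, h2, zero_smul, add_zero] at h4
  rw [(smul_eq_zero.1 h4.symm).resolve_left S.sign_ne_zero, zero_add] at hsum
  rw [← hsum]
  exact hF.horProj_mem p _

end AlmostContactStructure
end AntiInvariant

end LorentzianSubmersion

end

/-! ### The equivalence of the three conditions -/

theorem mainTheorem10
    {E : Type*} [NormedAddCommGroup E] [NormedSpace ℝ E] [FiniteDimensional ℝ E]
    {M : Type*} [TopologicalSpace M] [ChartedSpace E M] [IsManifold 𝓘(ℝ, E) ∞ M]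
    [T2Space M] [SecondCountableTopology M]
    {E' : Type*} [NormedAddCommGroup E'] [NormedSpace ℝ E'] [FiniteDimensional ℝ E']
    {N : Type*} [TopologicalSpace N] [ChartedSpace E' N] [IsManifold 𝓘(ℝ, E') ∞ N]
    [T2Space N] [SecondCountableTopology N]
    (gM : SemiRiemannianMetric E M) (gN : SemiRiemannianMetric E' N) (ε : ℝ)
    (S : AlmostContactStructure gM ε) (hS : S.IsSasakian) (hN : gN.IsRiemannian)
    (F : M → N) (hF : IsSemiRiemannianSubmersion gM gN F)
    (hanti : S.IsAntiInvariant (E' := E') F)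
    (hxi : ∀ p, S.xi p ∈ vertical (E := E) (E' := E') F p) :
    List.TFAE [
      IsIntegrable (horizontal (E' := E') gM F),
      ∀ X Y V : Π p : M, TangentSpace 𝓘(ℝ, E) p,
        IsSectionOf (horizontal (E' := E') gM F) X →
        IsSectionOf (horizontal (E' := E') gM F) Y →
        IsSectionOf (vertical (E := E) (E' := E') F) V → ∀ p,
          gN.val (F p) (secondFundamentalForm gM gN F Y (S.fieldB hF X) p)
              (mfderiv 𝓘(ℝ, E) 𝓘(ℝ, E') F p (S.phi p (V p))) =
            gN.val (F p) (secondFundamentalForm gM gN F X (S.fieldB hF Y) p)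
              (mfderiv 𝓘(ℝ, E) 𝓘(ℝ, E') F p (S.phi p (V p)))
            + ε * gM.val p (hF.tensorA X S.xi p) (S.phi p (hF.tensorA Y V p))
            - ε * gM.val p (hF.tensorA Y S.xi p) (S.phi p (hF.tensorA X V p)),
      ∀ X Y V : Π p : M, TangentSpace 𝓘(ℝ, E) p,
        IsSectionOf (horizontal (E' := E') gM F) X →
        IsSectionOf (horizontal (E' := E') gM F) Y →
        IsSectionOf (vertical (E := E) (E' := E') F) V → ∀ p,
          gM.val p (hF.tensorA X (S.fieldB hF Y) p - hF.tensorA Y (S.fieldB hF X) p)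
              (S.phi p (V p)) =
            ε * gM.val p (hF.tensorA X S.xi p) (S.phi p (hF.tensorA Y V p))
            - ε * gM.val p (hF.tensorA Y S.xi p) (S.phi p (hF.tensorA X V p))] := by
  obtain ⟨a, haa, ha⟩ := S.exists_covDerivPhi_eq hS
  tfae_have 2 ↔ 3 := by
    refine forall₃_congr fun X Y V ↦ forall₃_congr fun hX hY hV ↦ forall_congr' fun p ↦ ?_
    rw [hF.val_secondFundamentalForm hY.2 (S.fieldB_mem_vertical hF X),
      hF.val_secondFundamentalForm hX.2 (S.fieldB_mem_vertical hF Y), map_sub, sub_apply]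
    constructor <;> intro h <;> linarith
  tfae_have 1 → 3 := by
    intro hI X Y V hX hY hV p
    have hC := fun X hX p ↦ S.fieldC_eq_zero_of_isIntegrable hF hN hxi haa ha hI (X := X) hX p
    rw [← S.val_mlieBracket_of_fieldC_eq_zero hF hanti hxi ha hC hX hY (hV.2 p), gM.symm,
      hF.val_eq_zero p (hV.2 p) (hI X Y hX hY p), S.tensorA_xi hF hxi ha hX,
      S.tensorA_xi hF hxi ha hY, hC X hX, hC Y hY]
    simp
  tfae_have 3 → 1 := by
    intro h
    have hC := fun X hX p ↦ S.fieldC_eq_zero_of_tensorA hF hN hxi haa ha (fun X Y hX hY p ↦ by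
      -- Taking `V = ξ` makes the left side of (iii) vanish because `φξ = 0`, leaving a condition on
      -- `A_X ξ` and `A_Y ξ` alone.
      have h1 := h X Y S.xi hX hY ⟨S.contMDiff_xi, hxi⟩ p
      rwa [S.phi_xi, map_zero, eq_comm] at h1) (X := X) hX p
    refine S.isIntegrable_of_val_mlieBracket hN hF hanti hxi fun X Y V hX hY hV p ↦ ?_
    rw [S.val_mlieBracket_of_fieldC_eq_zero hF hanti hxi ha hC hX hY (hV.2 p), h X Y V hX hY hV,
      S.tensorA_xi hF hxi ha hX, S.tensorA_xi hF hxi ha hY, hC X hX, hC Y hY]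
    simp
  tfae_finish
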